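/- Let $f=\sum_{k\ge 0}a_kz^k$ be a formal power series with real coefficients $a_k$. For $n=0,1,2,\dots$ let $$A(f,n)(z)=\sum_{k=0}^{n}\frac{n!}{(n-k)!}\,a_k z^{n-k}$$ be the $n$-th Appell polynomial of $f$. For an entire function $g\not\equiv 0$ and $X\subset\mathbb C$, let $N(g;X)$ denote the number of zeros of $g$ in $X$, counted with multiplicity, and put $N(g;X)=0$ if $g\equiv 0$. Let $N_n=N(A(f,n);\mathbb C\setminus\mathbb R)$. The Laguerre–Pólya class $\mathcal{LP}$ consists of the entire functions of the form $$g(z)=c\,z^m e^{-\alpha z^2+\beta z}\prod_j\Bigl(1-\frac{z}{b_j}\Bigr)e^{z/b_j},$$ where $c,\beta\in\mathbb R$, $m$ is a nonnegative integer, $\alpha\ge 0$, and $(b_j)$ is a finite (possibly empty) or infinite sequence of nonzero real numbers with $\sum_j|b_j|^{-2}<\infty$. The class $\mathcal{LP}^*$ consists of the entire functions that map $\mathbb R$ into $\mathbb R$ and are of the form $Pg$ with $P$ a polynomial with real coefficients and $g\in\mathcal{LP}$. We say that $f$ represents an entire function if the series converges at every $z\in\mathbb C$; the function is then its sum. Then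 the following hold. 1. $0=N_0=N_1\le N_2\le N_3\le\cdots$. 2. If $f$ represents an entire function in $\mathcal{LP}^*$ (also denoted $f$) and $N=N(f;\mathbb C\setminus\mathbb R)$, then $N_n\le N$ for all $n$, and $N_n=N$ for all sufficiently large $n$. 3. If the sequence $\langle N_n\rangle$ is bounded, then $f$ represents an entire function in $\mathcal{LP}^*$. -/

import Mathlib

noncomputable section

namespace LaguerrePolya

/-- The function `F` is the entire function represented by the formal power series `f`:
the series converges at every complex point, with sum `F z`. -/
def Represents (f : PowerSeries ℝ) (F : ℂ → ℂ) : Prop :=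
  ∀ z : ℂ, HasSum (fun k : ℕ => ((PowerSeries.coeff k f : ℝ) : ℂ) * z ^ k) (F z)

/-- The `n`-th Appell polynomial `∑_{k=0}^n n!/(n-k)! a_k z^{n-k}` of `f = ∑ a_k z^k`. -/
def appell (f : PowerSeries ℝ) (n : ℕ) : Polynomial ℝ :=
  ∑ k ∈ Finset.range (n + 1),
    Polynomial.C ((n.factorial : ℝ) / ((n - k).factorial : ℝ) * PowerSeries.coeff k f) *
      Polynomial.X ^ (n - k)

open Classical in
/-- The number `N(F; X)` of zeros in `X` of the entire function `F`, counted according to their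
multiplicities (a zero `z` of order `m` contributes the pairs `(z, 0), …, (z, m - 1)`); it is `0`
by convention if `F` vanishes identically. -/
def zeroCount (F : ℂ → ℂ) (X : Set ℂ) : ℕ∞ :=
  if F = 0 then 0
  else Set.encard {p : ℂ × ℕ | p.1 ∈ X ∧ (p.2 : ℕ∞) < analyticOrderAt F p.1}

/-- The set `ℂ ∖ ℝ`. -/
def nonreal : Set ℂ := (Set.range ((↑) : ℝ → ℂ))ᶜ

/-- The number of non-real zeros of the `n`-th Appell polynomial of `f`. -/
def appellNonrealZeros (f : PowerSeries ℝ) (n : ℕ) : ℕ∞ :=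
  zeroCount (fun z : ℂ => Polynomial.aeval z (appell f n)) nonreal

/-- The Laguerre-Pólya class: the functions
`c z^m exp(-α z^2 + β z) ∏_j (1 - z / a_j) exp(z / a_j)` with `c, β, a_j` real, `α ≥ 0`,
`a_j ≠ 0` and `∑_j |a_j|^{-2} < ∞`. The (finite or infinite) family of the `a_j` is
indexed by a set `J` of natural numbers. -/
def IsLP (F : ℂ → ℂ) : Prop :=
  ∃ (c : ℝ) (m : ℕ) (α β : ℝ) (J : Set ℕ) (a : J → ℝ) (G : ℂ → ℂ),
    0 ≤ α ∧ (∀ j, a j ≠ 0) ∧ Summable (fun j => (|a j| ^ 2)⁻¹) ∧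
    (∀ z : ℂ, HasProd (fun j => (1 - z / (a j : ℂ)) * Complex.exp (z / (a j : ℂ))) (G z)) ∧
    ∀ z : ℂ, F z = (c : ℂ) * z ^ m * Complex.exp (-(α : ℂ) * z ^ 2 + (β : ℂ) * z) * G z

/-- Real entire functions: entire functions that map `ℝ` into `ℝ`. -/
def IsRealEntire (F : ℂ → ℂ) : Prop :=
  Differentiable ℂ F ∧ ∀ x : ℝ, ∃ y : ℝ, F (x : ℂ) = (y : ℂ)

/-- The class `LP*` of the real entire functions `P g` with `P` a real polynomial and `g` in the
Laguerre-Pólya class. -/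
def IsLPStar (F : ℂ → ℂ) : Prop :=
  IsRealEntire F ∧ ∃ (P : Polynomial ℝ) (g : ℂ → ℂ), IsLP g ∧
    ∀ z : ℂ, F z = Polynomial.aeval z P * g z

end LaguerrePolya

end

/-!
The reversal `z ^ n A(f, n)(1 / z)` of an Appell polynomial has as many non-real zeros as
`A(f, n)`. Since `A(f, n + 1)' = (n + 1) A(f, n)`, Rolle's theorem makes `N_n` monotone. Rescaling
the reversal to argument `z / n` gives polynomials that tend coefficientwise to `f`; conversely,
if polynomials `p` tend to `f`, then the reversal of `A(f, n)` is a limit of polynomials obtained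
from `p` by operations that create no non-real zeros, and a polynomial that is a limit of such
polynomials has at most as many non-real zeros as they have, by the factorization below. So
`N_n ≤ M` for all `n` if and only if `f`, divided by its lowest term, is a coefficientwise limit of
polynomials with value `1` at `0` and at most `M` non-real zeros.

To see that such a limit is in `LP*`, consider the reciprocals of the zeros. Their power sums
converge, and if the non-real ones were unbounded then so would be an even power sum, because
arbitrarily high powers of finitely many complex numbers are simultaneously almost positive. Hence
the non-real zeros split off in the limit as a polynomial factor. The real ones, sorted by size,
converge along a subsequence, and the power sums of the limits are those of the limit function, up
to the sum itself, which contributes a factor `exp (β z)`, and the sum of the squares, whose excess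
contributes the factor `exp (-α z ^ 2)`.
-/

namespace LaguerrePolya

open Filter Topology
open scoped PowerSeries.WithPiTopology

/-! ### Power sums -/

section PowerSeries

open PowerSeries

variable {K : Type*} [Field K]

theorem tendsto_powerSeries_inv [TopologicalSpace K] [IsTopologicalRing K] [ContinuousInv₀ K]
    {ι : Type*} {l : Filter ι} {f : ι → K⟦X⟧} {g : K⟦X⟧} (hg : constantCoeff g ≠ 0)
    (h : Tendsto f l (𝓝 g)) : Tendsto (fun i => (f i)⁻¹) l (𝓝 g⁻¹) := by
  rw [WithPiTopology.tendsto_iff_coeff_tendsto] at h ⊢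
  have h0 : Tendsto (fun i => (constantCoeff (f i))⁻¹) l (𝓝 (constantCoeff g)⁻¹) := by
    simpa using (h 0).inv₀ (by simpa using hg)
  intro k
  induction k using Nat.strong_induction_on with
  | _ k ih =>
    rw [coeff_inv]
    refine Tendsto.congr (fun i => (coeff_inv k (f i)).symm) ?_
    split_ifs with hk
    · exact h0
    · refine h0.neg.mul (tendsto_finsetSum _ fun x _ => ?_)
      split_ifs with hx
      · exact (h x.1).mul (ih x.2 hx)
      · exact tendsto_const_nhds

/-- The power series `-X f' / f`. If `f = ∏ (1 - b_j X)` then its `k`-th coefficient is the power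
sum `∑ b_j ^ k` for `k ≥ 1`; its constant coefficient is always `0`. -/
noncomputable def powerSums (f : K⟦X⟧) : K⟦X⟧ := -(X * derivative K f * f⁻¹)

theorem powerSums_eq_iff {f S : K⟦X⟧} (hf : constantCoeff f ≠ 0) :
    powerSums f = S ↔ X * derivative K f = -(f * S) := by
  have hinv : f * f⁻¹ = 1 := PowerSeries.mul_inv_cancel f hf
  constructor
  · rintro rfl
    rw [powerSums]
    linear_combination (-(X * derivative K f)) * hinv
  · intro h
    rw [powerSums, h]
    linear_combination S * hinv

theorem powerSums_one : powerSums (1 : K⟦X⟧) = 0 := by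
  simp [powerSums]

theorem powerSums_mul {f g : K⟦X⟧} (hf : constantCoeff f ≠ 0) (hg : constantCoeff g ≠ 0) :
    powerSums (f * g) = powerSums f + powerSums g := by
  rw [powerSums_eq_iff (by simp [hf, hg]), Derivation.leibniz, smul_eq_mul, smul_eq_mul]
  linear_combination f * (powerSums_eq_iff hg).1 rfl + g * (powerSums_eq_iff hf).1 rfl

theorem powerSums_prod {ι : Type*} (s : Finset ι) {f : ι → K⟦X⟧}
    (hf : ∀ i, constantCoeff (f i) ≠ 0) :
    powerSums (∏ i ∈ s, f i) = ∑ i ∈ s, powerSums (f i) := by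
  classical
  induction s using Finset.induction_on with
  | empty => exact powerSums_one
  | insert a s ha ih =>
    have hs : constantCoeff (∏ i ∈ s, f i) ≠ 0 := by
      rw [map_prod]
      exact Finset.prod_ne_zero_iff.2 fun i _ => hf i
    rw [Finset.prod_insert ha, Finset.sum_insert ha, powerSums_mul (hf a) hs, ih]

theorem powerSums_map {L : Type*} [Field L] (φ : K →+* L) {f : K⟦X⟧} (hf : constantCoeff f ≠ 0) :
    powerSums (map φ f) = map φ (powerSums f) := by
  have hf' : constantCoeff (map φ f) ≠ 0 := by
    rwa [← coeff_zero_eq_constantCoeff_apply, coeff_map, map_ne_zero,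
      coeff_zero_eq_constantCoeff_apply]
  have hderiv : derivative L (map φ f) = map φ (derivative K f) := by
    ext k
    simp [coeff_derivative]
  rw [powerSums_eq_iff hf', hderiv, ← map_X φ, ← map_mul, (powerSums_eq_iff hf).1 rfl, map_neg,
    map_mul]

theorem powerSums_one_sub (b : K) :
    powerSums (1 - C b * X) = mk fun k => if k = 0 then 0 else b ^ k := by
  rw [powerSums_eq_iff (by simp), map_sub, derivative_one, Derivation.leibniz, derivative_X,
    derivative_C, smul_eq_mul, mul_one, smul_zero, add_zero, zero_sub]
  ext k
  rcases k with _ | _ | k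
  · simp
  · simp [sub_mul, mul_assoc, coeff_succ_X_mul]
  · simp [sub_mul, mul_assoc, coeff_succ_X_mul, coeff_X, pow_succ']

theorem eq_of_powerSums_eq [CharZero K] {f g : K⟦X⟧} (hf : constantCoeff f ≠ 0)
    (hfg : constantCoeff f = constantCoeff g) (h : powerSums f = powerSums g) : f = g := by
  have hg : constantCoeff g ≠ 0 := hfg ▸ hf
  have hinv : g * g⁻¹ = 1 := PowerSeries.mul_inv_cancel g hg
  have hwronskian : g * derivative K f = f * derivative K g := by
    refine mul_left_cancel₀ X_ne_zero ?_
    linear_combination g * (powerSums_eq_iff hf).1 rfl - f * (powerSums_eq_iff hg).1 rfl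
      + (-(g * f)) * h
  have hquot : f * g⁻¹ = 1 := by
    refine derivative.ext ?_ (by simp [hfg, hg])
    rw [derivative_one, Derivation.leibniz, derivative_inv', smul_eq_mul, smul_eq_mul]
    linear_combination (g⁻¹ ^ 2) * hwronskian - (derivative K f * g⁻¹) * hinv
  linear_combination g * hquot - f * hinv

theorem tendsto_powerSums [TopologicalSpace K] [IsTopologicalRing K] [ContinuousInv₀ K]
    {ι : Type*} {l : Filter ι} {f : ι → K⟦X⟧} {g : K⟦X⟧} (hg : constantCoeff g ≠ 0)
    (h : Tendsto f l (𝓝 g)) : Tendsto (fun i => powerSums (f i)) l (𝓝 (powerSums g)) := by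
  have hderiv : Tendsto (fun i => derivative K (f i)) l (𝓝 (derivative K g)) := by
    rw [WithPiTopology.tendsto_iff_coeff_tendsto] at h ⊢
    intro k
    simp only [coeff_derivative]
    exact (h (k + 1)).mul_const _
  exact ((tendsto_const_nhds.mul hderiv).mul (tendsto_powerSeries_inv hg h)).neg

theorem exists_powerSeries_eq_C_mul_X_pow_mul {f : K⟦X⟧} (hf : f ≠ 0) :
    ∃ (c : K) (m : ℕ) (h : K⟦X⟧), c ≠ 0 ∧ constantCoeff h = 1 ∧
      f = C c * X ^ m * h := by
  set g := f.divXPowOrder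
  set c := constantCoeff g
  have hc : c ≠ 0 := by
    rw [show c = _ from constantCoeff_divXPowOrder]
    exact coeff_order hf
  refine ⟨c, f.order.toNat, C c⁻¹ * g, hc, by simp [c, hc], ?_⟩
  calc f = X ^ f.order.toNat * g := X_pow_order_mul_divXPowOrder.symm
    _ = C c * X ^ f.order.toNat * (C c⁻¹ * g) := by
      have : C c * C c⁻¹ = (1 : K⟦X⟧) := by
        rw [← map_mul, mul_inv_cancel₀ hc, map_one]
      linear_combination (-(X ^ f.order.toNat * g)) * this

end PowerSeries

open Polynomial

/-! ### Roots outside the base field -/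

section RootDefect

variable {K : Type*} [Field K]

/-- The number of zeros of a polynomial, counted with multiplicity, that lie in an algebraic
closure of `K` but not in `K`: the degree minus the number of roots in `K`. For `K = ℝ` this is
the number of non-real zeros. -/
noncomputable def rootDefect (p : K[X]) : ℕ := p.natDegree - p.roots.card

theorem rootDefect_add_card_roots (p : K[X]) : rootDefect p + p.roots.card = p.natDegree :=
  Nat.sub_add_cancel p.card_roots'

theorem rootDefect_le_natDegree (p : K[X]) : rootDefect p ≤ p.natDegree := Nat.sub_le _ _

@[simp] theorem rootDefect_zero : rootDefect (0 : K[X]) = 0 := by simp [rootDefect]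

theorem rootDefect_eq_zero_iff {p : K[X]} : rootDefect p = 0 ↔ p.Splits := by
  rw [splits_iff_card_roots, rootDefect, Nat.sub_eq_zero_iff_le]
  exact ⟨p.card_roots'.antisymm, fun h => h.ge⟩

theorem exists_splits_mul (p : K[X]) :
    ∃ s q : K[X], p = s * q ∧ s.Splits ∧ q.natDegree = rootDefect p := by
  obtain ⟨q, hq, hdeg, -⟩ := p.exists_prod_multiset_X_sub_C_mul
  refine ⟨_, q, hq.symm, Splits.multisetProd ?_, ?_⟩
  · intro f hf
    obtain ⟨a, -, rfl⟩ := Multiset.mem_map.1 hf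
    exact Splits.X_sub_C a
  · have := rootDefect_add_card_roots p
    omega

theorem rootDefect_mul {p q : K[X]} (hpq : p * q ≠ 0) :
    rootDefect (p * q) = rootDefect p + rootDefect q := by
  have hp := rootDefect_add_card_roots p
  have hq := rootDefect_add_card_roots q
  rw [rootDefect, roots_mul hpq, Multiset.card_add,
    natDegree_mul (left_ne_zero_of_mul hpq) (right_ne_zero_of_mul hpq)]
  omega

theorem rootDefect_mul_le (p q : K[X]) : rootDefect (p * q) ≤ rootDefect p + rootDefect q := by
  rcases eq_or_ne (p * q) 0 with h | h
  · simp [h]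
  · exact (rootDefect_mul h).le

theorem rootDefect_splits_mul_le {s : K[X]} (hs : s.Splits) (q : K[X]) :
    rootDefect (s * q) ≤ q.natDegree := by
  have := rootDefect_mul_le s q
  rw [rootDefect_eq_zero_iff.2 hs, zero_add] at this
  exact this.trans (rootDefect_le_natDegree q)

theorem rootDefect_splits_mul {s : K[X]} (hs : s.Splits) (hs0 : s ≠ 0) (q : K[X]) :
    rootDefect (s * q) = rootDefect q := by
  rcases eq_or_ne q 0 with rfl | hq
  · simp
  · rw [rootDefect_mul (mul_ne_zero hs0 hq), rootDefect_eq_zero_iff.2 hs, zero_add]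

theorem rootDefect_C_mul {c : K} (hc : c ≠ 0) (p : K[X]) : rootDefect (C c * p) = rootDefect p :=
  rootDefect_splits_mul (Splits.C c) (C_ne_zero.2 hc) p

theorem splits_reverse {s : K[X]} (hs : s.Splits) : s.reverse.Splits := by
  have reverse_linear (a : K) : (X - C a).reverse.Splits :=
    Splits.of_natDegree_le_one ((reverse_natDegree_le _).trans (natDegree_X_sub_C_le a))
  rw [hs.eq_prod_roots, reverse_mul_of_domain, reverse_C]
  refine (Splits.C _).mul ?_
  induction s.roots using Multiset.induction_on with
  | empty => rw [Multiset.map_zero, Multiset.prod_zero, ← C_1, reverse_C]; exact Splits.C _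
  | cons a m ih =>
    rw [Multiset.map_cons, Multiset.prod_cons, reverse_mul_of_domain]
    exact (reverse_linear a).mul ih

theorem rootDefect_reverse_le (p : K[X]) : rootDefect p.reverse ≤ rootDefect p := by
  obtain ⟨s, q, h, hs, hq⟩ := exists_splits_mul p
  rw [← hq]
  calc rootDefect p.reverse = rootDefect (s.reverse * q.reverse) := by
        rw [h, reverse_mul_of_domain]
    _ ≤ q.reverse.natDegree := rootDefect_splits_mul_le (splits_reverse hs) _
    _ ≤ q.natDegree := reverse_natDegree_le q

theorem reflect_eq_X_pow_mul_reverse {N : ℕ} {p : K[X]} (h : p.natDegree ≤ N) :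
    reflect N p = X ^ (N - p.natDegree) * p.reverse := by
  have := reflect_mul (1 : K[X]) p (F := N - p.natDegree) (by simp) le_rfl
  rwa [Nat.sub_add_cancel h, one_mul, reflect_one] at this

theorem rootDefect_reflect_le {N : ℕ} {p : K[X]} (h : p.natDegree ≤ N) :
    rootDefect (reflect N p) ≤ rootDefect p := by
  rw [reflect_eq_X_pow_mul_reverse h, rootDefect_splits_mul (Splits.X_pow _) (by simp)]
  exact rootDefect_reverse_le p

theorem rootDefect_reflect {N : ℕ} {p : K[X]} (h : p.natDegree ≤ N) :
    rootDefect (reflect N p) = rootDefect p := by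
  refine (rootDefect_reflect_le h).antisymm ?_
  have hN : (reflect N p).natDegree ≤ N := natDegree_reflect_le.trans (max_le le_rfl h)
  have hinvol : reflect N (reflect N p) = p := by ext k; simp
  simpa only [hinvol] using rootDefect_reflect_le hN

theorem rootDefect_comp_le (p : K[X]) {l : K[X]} (hl : l.natDegree ≤ 1) :
    rootDefect (p.comp l) ≤ rootDefect p := by
  obtain ⟨s, q, h, hs, hq⟩ := exists_splits_mul p
  rw [← hq]
  calc rootDefect (p.comp l) = rootDefect (s.comp l * q.comp l) := by rw [h, mul_comp]
    _ ≤ (q.comp l).natDegree := rootDefect_splits_mul_le (hs.comp_of_natDegree_le_one hl) _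
    _ ≤ q.natDegree * l.natDegree := natDegree_comp_le
    _ ≤ q.natDegree := by simpa using Nat.mul_le_mul_left q.natDegree hl

end RootDefect

theorem rootDefect_derivative_le (p : ℝ[X]) : rootDefect (derivative p) ≤ rootDefect p := by
  have rolle := p.card_roots_le_derivative
  have hdeg := natDegree_derivative_le p
  have hp := rootDefect_add_card_roots p
  have hp' := rootDefect_add_card_roots (derivative p)
  rcases Nat.eq_zero_or_pos p.natDegree with h | h <;> omega

theorem rootDefect_iterate_derivative_le (p : ℝ[X]) (k : ℕ) :
    rootDefect (derivative^[k] p) ≤ rootDefect p := by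
  induction k with
  | zero => rfl
  | succ k ih =>
    rw [Function.iterate_succ_apply']
    exact (rootDefect_derivative_le _).trans ih

/-! ### Counting zeros -/

theorem analyticOrderAt_polynomial_eval {P : ℂ[X]} (hP : P ≠ 0) (z : ℂ) :
    analyticOrderAt (fun w => P.eval w) z = P.roots.count z := by
  rw [(P.differentiable.analyticAt z).analyticOrderAt_eq_natCast, count_roots]
  obtain ⟨Q, hQ, hdvd⟩ := exists_eq_pow_rootMultiplicity_mul_and_not_dvd P hP z
  refine ⟨fun w => Q.eval w, Q.differentiable.analyticAt z, fun h => hdvd (dvd_iff_isRoot.2 h),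
    Eventually.of_forall fun w => ?_⟩
  simpa using congrArg (eval w) hQ

open Classical in
theorem zeroCount_polynomial_eval (P : ℂ[X]) (S : Set ℂ) :
    zeroCount (fun w => P.eval w) S = (P.roots.filter (· ∈ S)).card := by
  have heval : (fun w => P.eval w) = 0 ↔ P = 0 :=
    ⟨fun h => Polynomial.funext fun w => by simpa using congrFun h w,
      fun h => by ext; simp [h]⟩
  rcases eq_or_ne P 0 with rfl | hP
  · rw [zeroCount, if_pos (heval.2 rfl)]
    simp
  have hzeros : {x : ℂ × ℕ | x.1 ∈ S ∧ (x.2 : ℕ∞) < analyticOrderAt (fun w => P.eval w) x.1}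
      = (P.roots.filter (· ∈ S)).toEnumFinset := by
    ext ⟨z, k⟩
    simp only [analyticOrderAt_polynomial_eval hP, Set.mem_ofPred_eq, Finset.mem_coe,
      Multiset.mem_toEnumFinset, Multiset.count_filter, Nat.cast_lt]
    split_ifs with hz <;> simp [hz]
  rw [zeroCount, if_neg (heval.not.2 hP), hzeros, Set.encard_coe_eq_coe_finsetCard,
    Multiset.card_toEnumFinset]

theorem zeroCount_mul_of_ne_zero {F G : ℂ → ℂ} {S : Set ℂ} (hF : Differentiable ℂ F)
    (hG : Differentiable ℂ G) (hS : S.Nonempty) (hG0 : ∀ z ∈ S, G z ≠ 0) :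
    zeroCount (F * G) S = zeroCount F S := by
  have horder : ∀ z ∈ S, analyticOrderAt (F * G) z = analyticOrderAt F z := fun z hz => by
    rw [analyticOrderAt_mul (hF.analyticAt z) (hG.analyticAt z),
      (hG.analyticAt z).analyticOrderAt_eq_zero.2 (hG0 z hz), add_zero]
  have hzero : F * G = 0 ↔ F = 0 := by
    refine ⟨fun h => ?_, fun h => by simp [h]⟩
    obtain ⟨z, hz⟩ := hS
    have htop := horder z hz
    rw [h, show analyticOrderAt (0 : ℂ → ℂ) z = ⊤ from analyticOrderAt_eq_top.2 (by simp), eq_comm,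
      analyticOrderAt_eq_top] at htop
    exact AnalyticOnNhd.eq_of_eventuallyEq (fun w _ => hF.analyticAt w)
      (fun w _ => analyticAt_const) htop
  have hpairs : {p : ℂ × ℕ | p.1 ∈ S ∧ (p.2 : ℕ∞) < analyticOrderAt (F * G) p.1}
      = {p : ℂ × ℕ | p.1 ∈ S ∧ (p.2 : ℕ∞) < analyticOrderAt F p.1} :=
    Set.ext fun p => and_congr_right fun hp => by rw [horder p.1 hp]
  unfold zeroCount
  rw [hpairs]
  congr! 1

theorem I_mem_nonreal : Complex.I ∈ nonreal := by
  rintro ⟨x, hx⟩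
  simpa using congrArg Complex.im hx

theorem zeroCount_aeval (p : ℝ[X]) :
    zeroCount (fun z => aeval z p) nonreal = rootDefect p := by
  classical
  have hreal : ((p.map (algebraMap ℝ ℂ)).roots.filter (· ∈ (algebraMap ℝ ℂ).range)).card
      = p.roots.card := by
    rw [filter_roots_map_range_eq_map_roots (algebraMap ℝ ℂ).injective, Multiset.card_map]
  have htotal := congrArg Multiset.card <|
    Multiset.filter_add_not (· ∈ (algebraMap ℝ ℂ).range) (p.map (algebraMap ℝ ℂ)).roots
  rw [Multiset.card_add, hreal,
    ← (IsAlgClosed.splits (p.map (algebraMap ℝ ℂ))).natDegree_eq_card_roots,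
    natDegree_map] at htotal
  simp only [← eval_map_algebraMap]
  rw [zeroCount_polynomial_eval, rootDefect, ← htotal, Nat.add_sub_cancel_left]
  congr!

theorem zeroCount_aeval_mul {p : ℝ[X]} {G : ℂ → ℂ} (hG : Differentiable ℂ G)
    (hG0 : ∀ z ∈ nonreal, G z ≠ 0) :
    zeroCount (fun z => aeval z p * G z) nonreal = rootDefect p :=
  (zeroCount_mul_of_ne_zero (Polynomial.differentiable_aeval p) hG ⟨_, I_mem_nonreal⟩ hG0).trans
    (zeroCount_aeval p)

/-! ### Appell and Jensen polynomials -/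

theorem coeff_appell (f : PowerSeries ℝ) (n j : ℕ) :
    (appell f n).coeff j =
      if j ≤ n then (n.factorial : ℝ) / j.factorial * PowerSeries.coeff (n - j) f else 0 := by
  simp only [appell, finsetSum_coeff, coeff_C_mul, coeff_X_pow]
  split_ifs with h
  · rw [Finset.sum_eq_single_of_mem (n - j) (Finset.mem_range.2 (by lia)),
      if_pos (by lia), Nat.sub_sub_self h, mul_one]
    intro k hk hkj
    rw [if_neg (by grind), mul_zero]
  · exact Finset.sum_eq_zero fun k _ => by rw [if_neg (by lia), mul_zero]

theorem natDegree_appell_le (f : PowerSeries ℝ) (n : ℕ) : (appell f n).natDegree ≤ n :=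
  natDegree_le_iff_coeff_eq_zero.2 fun j hj => by rw [coeff_appell, if_neg (by lia)]

theorem derivative_appell_succ (f : PowerSeries ℝ) (n : ℕ) :
    derivative (appell f (n + 1)) = C ((n : ℝ) + 1) * appell f n := by
  ext j
  rw [coeff_derivative, coeff_C_mul, coeff_appell, coeff_appell]
  by_cases h : j ≤ n
  · rw [if_pos h, if_pos (by lia), Nat.succ_sub_succ, Nat.factorial_succ, Nat.factorial_succ]
    push_cast
    field_simp
  · rw [if_neg h, if_neg (by lia), zero_mul, mul_zero]

theorem rootDefect_appell_mono (f : PowerSeries ℝ) : Monotone fun n => rootDefect (appell f n) :=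
  monotone_nat_of_le_succ fun n => by
    have h := rootDefect_derivative_le (appell f (n + 1))
    rwa [derivative_appell_succ, rootDefect_C_mul (by positivity)] at h

theorem appell_C_mul_X_pow_mul (c : ℝ) (m : ℕ) (h : PowerSeries ℝ) (n : ℕ) :
    appell (PowerSeries.C c * PowerSeries.X ^ m * h) (n + m)
      = C (c * ((n + m).factorial / n.factorial)) * appell h n := by
  ext j
  rw [coeff_C_mul, coeff_appell, coeff_appell, mul_assoc, PowerSeries.coeff_C_mul,
    PowerSeries.coeff_X_pow_mul']
  by_cases hj : j ≤ n
  · rw [if_pos (by lia), if_pos (by lia), if_pos hj, show n + m - j - m = n - j by lia]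
    field_simp
  · have hjm : ¬ m ≤ n + m - j ∨ ¬ j ≤ n + m := by lia
    rcases hjm with hjm | hjm <;> simp [hj, hjm]

theorem forall_rootDefect_appell_C_mul_X_pow_mul_le_iff {c : ℝ} (hc : c ≠ 0) (m : ℕ)
    (h : PowerSeries ℝ) (M : ℕ) :
    (∀ n, rootDefect (appell (PowerSeries.C c * PowerSeries.X ^ m * h) n) ≤ M) ↔
      ∀ n, rootDefect (appell h n) ≤ M := by
  have hshift (n : ℕ) : rootDefect (appell (PowerSeries.C c * PowerSeries.X ^ m * h) (n + m))
      = rootDefect (appell h n) := by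
    rw [appell_C_mul_X_pow_mul, rootDefect_C_mul (by positivity)]
  refine ⟨fun H n => hshift n ▸ H (n + m), fun H n => ?_⟩
  exact (rootDefect_appell_mono _ (Nat.le_add_right n m)).trans ((hshift n).trans_le (H n))

/-- The Jensen polynomial `∑_{k=0}^n n!/(n-k)! a_k z^k` of `f = ∑ a_k z^k`, that is
`z^n A(f,n)(1/z)`. -/
noncomputable def jensen (f : PowerSeries ℝ) (n : ℕ) : ℝ[X] := reflect n (appell f n)

theorem coeff_jensen (f : PowerSeries ℝ) (n k : ℕ) :
    (jensen f n).coeff k = n.descFactorial k * PowerSeries.coeff k f := by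
  rw [jensen, coeff_reflect]
  rcases le_or_gt k n with hk | hk
  · rw [revAt_le hk, coeff_appell, if_pos (Nat.sub_le n k), Nat.sub_sub_self hk,
      ← Nat.factorial_mul_descFactorial hk, Nat.cast_mul, mul_div_cancel_left₀ _ (by positivity)]
  · rw [revAt_eq_self_of_lt hk, coeff_appell, if_neg (by lia),
      Nat.descFactorial_of_lt hk, Nat.cast_zero, zero_mul]

theorem rootDefect_jensen (f : PowerSeries ℝ) (n : ℕ) :
    rootDefect (jensen f n) = rootDefect (appell f n) :=
  rootDefect_reflect (natDegree_appell_le f n)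

theorem continuous_jensen (n : ℕ) :
    Continuous fun f : PowerSeries ℝ => (jensen f n : PowerSeries ℝ) := by
  rw [continuous_iff_continuousAt]
  intro f
  rw [ContinuousAt, PowerSeries.WithPiTopology.tendsto_iff_coeff_tendsto]
  intro k
  simp only [coeff_coe, coeff_jensen]
  exact ((PowerSeries.WithPiTopology.continuous_coeff ℝ k).tendsto f).const_mul _

theorem tendsto_descFactorial_div_pow (k : ℕ) :
    Tendsto (fun n : ℕ => (n.descFactorial k : ℝ) / n ^ k) atTop (𝓝 1) := by
  refine (Asymptotics.isEquivalent_iff_tendsto_one ?_).1 (isEquivalent_descFactorial k)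
  filter_upwards [eventually_gt_atTop 0] with n hn
  positivity

theorem tendsto_jensen_comp (f : PowerSeries ℝ) :
    Tendsto (fun n : ℕ => ((jensen f n).comp (C (n : ℝ)⁻¹ * X) : PowerSeries ℝ)) atTop (𝓝 f) := by
  rw [PowerSeries.WithPiTopology.tendsto_iff_coeff_tendsto]
  intro k
  have h := (tendsto_descFactorial_div_pow k).mul_const (PowerSeries.coeff k f)
  rw [one_mul] at h
  refine h.congr fun n => ?_
  rw [coeff_coe, comp_C_mul_X_coeff, coeff_jensen, inv_pow]
  ring

/-- Polynomials that tend to the Jensen polynomial `jensen p n` as `r → ∞` and are obtained from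
`p` by reversals, rescalings and differentiations only, so that their root defect is at most that
of `p`. -/
noncomputable def jensenApprox (p : ℝ[X]) (n r : ℕ) : ℝ[X] :=
  C ((n + r).descFactorial r : ℝ)⁻¹ *
    (reflect n (derivative^[r] (reflect (n + r) p))).comp (C ((n + r : ℕ) : ℝ) * X)

section JensenApprox

variable {p : ℝ[X]} {n r : ℕ}

theorem natDegree_iterate_derivative_reflect_le (h : p.natDegree ≤ n + r) :
    (derivative^[r] (reflect (n + r) p)).natDegree ≤ n := by
  have hderiv := natDegree_iterate_derivative (reflect (n + r) p) r
  have hreflect := natDegree_reflect_le (N := n + r) (p := p)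
  lia

theorem rootDefect_jensenApprox_le (h : p.natDegree ≤ n + r) :
    rootDefect (jensenApprox p n r) ≤ rootDefect p :=
  calc rootDefect (jensenApprox p n r)
      ≤ rootDefect (reflect n (derivative^[r] (reflect (n + r) p))) := by
        rw [jensenApprox, rootDefect_C_mul (by simp [Nat.descFactorial_eq_zero_iff_lt])]
        exact rootDefect_comp_le _ ((natDegree_C_mul_le _ _).trans natDegree_X_le)
    _ ≤ rootDefect (derivative^[r] (reflect (n + r) p)) :=
        rootDefect_reflect_le (natDegree_iterate_derivative_reflect_le h)
    _ ≤ rootDefect (reflect (n + r) p) := rootDefect_iterate_derivative_le _ r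
    _ ≤ rootDefect p := rootDefect_reflect_le h

theorem coeff_jensenApprox (h : p.natDegree ≤ n + r) {k : ℕ} (hk : k ≤ n + r) :
    (jensenApprox p n r).coeff k =
      n.descFactorial k * p.coeff k * ((n + r).descFactorial k / ((n + r : ℕ) : ℝ) ^ k)⁻¹ := by
  rw [jensenApprox, coeff_C_mul, comp_C_mul_X_coeff, coeff_reflect]
  rcases le_or_gt k n with hkn | hkn
  · have hdesc : ((n + r - k).descFactorial r : ℝ) * (n + r).descFactorial k
        = n.descFactorial k * (n + r).descFactorial r := by
      norm_cast
      have h1 := Nat.descFactorial_mul_descFactorial (n := n + r) (Nat.le_add_left k r)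
      have h2 := Nat.descFactorial_mul_descFactorial (n := n + r) (Nat.le_add_left r k)
      rw [Nat.add_sub_cancel] at h1 h2
      rw [h1, add_comm r k, ← h2, Nat.add_sub_cancel]
    have hr : ((n + r).descFactorial r : ℝ) ≠ 0 := by simp [Nat.descFactorial_eq_zero_iff_lt]
    have hk0 : ((n + r).descFactorial k : ℝ) ≠ 0 := by
      simp [Nat.descFactorial_eq_zero_iff_lt, hk]
    rw [revAt_le hkn, coeff_iterate_derivative, coeff_reflect, revAt_le (by lia), nsmul_eq_mul,
      show n - k + r = n + r - k by lia, Nat.sub_sub_self hk]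
    field_simp
    linear_combination p.coeff k * ((n + r : ℕ) : ℝ) ^ k * hdesc
  · rw [revAt_eq_self_of_lt hkn, Nat.descFactorial_of_lt hkn, coeff_eq_zero_of_natDegree_lt
      ((natDegree_iterate_derivative_reflect_le h).trans_lt hkn)]
    simp

theorem tendsto_jensenApprox (p : ℝ[X]) (n : ℕ) :
    Tendsto (fun r => (jensenApprox p n r : PowerSeries ℝ)) atTop
      (𝓝 (jensen (p : PowerSeries ℝ) n : PowerSeries ℝ)) := by
  rw [PowerSeries.WithPiTopology.tendsto_iff_coeff_tendsto]
  intro k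
  have hlim := ((tendsto_descFactorial_div_pow k).comp
    (tendsto_atTop_mono (Nat.le_add_left · n) tendsto_id)).inv₀ one_ne_zero
  simp only [coeff_coe, coeff_jensen]
  have hlim := hlim.const_mul (n.descFactorial k * p.coeff k)
  rw [inv_one, mul_one] at hlim
  refine hlim.congr' ?_
  filter_upwards [eventually_ge_atTop (p.natDegree + k)] with r hr
  exact (coeff_jensenApprox (by lia) (by lia)).symm

end JensenApprox

/-! ### Real power series of entire functions -/

theorem isClosed_range_ofReal : IsClosed (Set.range ((↑) : ℝ → ℂ)) :=
  Complex.isUniformEmbedding_ofReal.isClosedEmbedding.isClosed_range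

theorem hasSum_iteratedDeriv_zero {F : ℂ → ℂ} (hF : Differentiable ℂ F) (z : ℂ) :
    HasSum (fun k : ℕ => ((k.factorial : ℂ)⁻¹ * iteratedDeriv k F 0) * z ^ k) (F z) := by
  refine (Complex.hasSum_taylorSeries_of_entire hF 0 z).congr_fun fun k => ?_
  simp only [sub_zero, smul_eq_mul]
  ring

theorem represents_iff {f : PowerSeries ℝ} {F : ℂ → ℂ} :
    Represents f F ↔ Differentiable ℂ F ∧
      ∀ k, ((PowerSeries.coeff k f : ℝ) : ℂ) = (k.factorial : ℂ)⁻¹ * iteratedDeriv k F 0 := by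
  have hasFPowerSeries {a : ℕ → ℂ} (h : ∀ z, HasSum (fun k => a k * z ^ k) (F z)) :
      HasFPowerSeriesOnBall F (FormalMultilinearSeries.ofScalars ℂ a) 0 ⊤ := by
    have hr : (FormalMultilinearSeries.ofScalars ℂ a).radius = ⊤ := by
      refine FormalMultilinearSeries.radius_eq_top_of_summable_norm _ fun r => ?_
      refine (h (r : ℝ)).summable.norm.congr fun k => ?_
      simp
    refine ⟨hr.ge, by simp, fun {y} _ => ?_⟩
    simpa [FormalMultilinearSeries.ofScalars_apply_eq, mul_comm] using h y
  constructor
  · intro h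
    have hF : Differentiable ℂ F := by
      rw [← differentiableOn_univ]
      simpa using (hasFPowerSeries h).differentiableOn
    refine ⟨hF, fun k => ?_⟩
    have heq := (hasFPowerSeries h).hasFPowerSeriesAt.eq_formalMultilinearSeries
      (hasFPowerSeries (hasSum_iteratedDeriv_zero hF)).hasFPowerSeriesAt
    exact congrFun (FormalMultilinearSeries.ofScalars_series_injective ℂ ℂ heq) k
  · rintro ⟨hF, hcoeff⟩ z
    simpa only [hcoeff] using hasSum_iteratedDeriv_zero hF z

theorem Represents.differentiable {f : PowerSeries ℝ} {F : ℂ → ℂ} (h : Represents f F) :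
    Differentiable ℂ F :=
  (represents_iff.1 h).1

theorem Represents.unique_left {f g : PowerSeries ℝ} {F : ℂ → ℂ} (hf : Represents f F)
    (hg : Represents g F) : f = g := by
  ext k
  exact_mod_cast ((represents_iff.1 hf).2 k).trans ((represents_iff.1 hg).2 k).symm

theorem Represents.unique_right {f : PowerSeries ℝ} {F G : ℂ → ℂ} (hF : Represents f F)
    (hG : Represents f G) : F = G :=
  funext fun z => (hF z).unique (hG z)

theorem Represents.constantCoeff {f : PowerSeries ℝ} {F : ℂ → ℂ} (h : Represents f F) :
    ((PowerSeries.constantCoeff f : ℝ) : ℂ) = F 0 := by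
  simpa using (represents_iff.1 h).2 0

theorem Represents.isRealEntire {f : PowerSeries ℝ} {F : ℂ → ℂ} (h : Represents f F) :
    IsRealEntire F := by
  refine ⟨h.differentiable, fun x => ?_⟩
  have hmem : F x ∈ Set.range ((↑) : ℝ → ℂ) :=
    isClosed_range_ofReal.mem_of_tendsto (h x) <| Eventually.of_forall fun s =>
      ⟨∑ k ∈ s, PowerSeries.coeff k f * x ^ k, by push_cast; rfl⟩
  exact hmem.imp fun y hy => hy.symm

theorem Represents.deriv {f : PowerSeries ℝ} {F : ℂ → ℂ} (h : Represents f F) :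
    Represents (PowerSeries.derivative ℝ f) (deriv F) := by
  obtain ⟨hF, hcoeff⟩ := represents_iff.1 h
  refine represents_iff.2 ⟨hF.deriv, fun k => ?_⟩
  rw [PowerSeries.coeff_derivative, Complex.ofReal_mul, hcoeff, iteratedDeriv_succ',
    Nat.factorial_succ]
  have : ((k : ℂ) + 1) ≠ 0 := k.cast_add_one_ne_zero
  push_cast
  field_simp

theorem Represents.mul {f g : PowerSeries ℝ} {F G : ℂ → ℂ} (hf : Represents f F)
    (hg : Represents g G) : Represents (f * g) (fun z => F z * G z) := by
  intro z
  have hcauchy := summable_norm_sum_mul_antidiagonal_of_summable_norm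
    (hf z).summable.norm (hg z).summable.norm
  have hsum := tsum_mul_tsum_eq_tsum_sum_antidiagonal_of_summable_norm
    (hf z).summable.norm (hg z).summable.norm
  rw [(hf z).tsum_eq, (hg z).tsum_eq] at hsum
  beta_reduce
  rw [hsum]
  refine hcauchy.of_norm.hasSum.congr_fun fun k => ?_
  rw [PowerSeries.coeff_mul]
  push_cast
  rw [Finset.sum_mul]
  refine Finset.sum_congr rfl fun x hx => ?_
  rw [← Finset.HasAntidiagonal.mem_antidiagonal.1 hx, pow_add]
  ring

theorem represents_coe (p : ℝ[X]) : Represents (p : PowerSeries ℝ) (fun z => aeval z p) := by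
  intro z
  simp only [aeval_eq_sum_range, Algebra.smul_def, Polynomial.coeff_coe]
  refine hasSum_sum_of_ne_finset_zero fun k hk => ?_
  rw [coeff_eq_zero_of_natDegree_lt (by simpa using hk), Complex.ofReal_zero, zero_mul]

theorem represents_prod {ι : Type*} (s : Finset ι) {f : ι → PowerSeries ℝ} {F : ι → ℂ → ℂ}
    (h : ∀ i, Represents (f i) (F i)) :
    Represents (∏ i ∈ s, f i) (fun z => ∏ i ∈ s, F i z) := by
  classical
  induction s using Finset.induction_on with
  | empty => simpa using represents_coe 1
  | insert a s ha ih =>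
    simp only [Finset.prod_insert ha]
    exact (h a).mul ih

theorem tendstoLocallyUniformlyOn_iteratedDeriv {ι : Type*} {l : Filter ι} {F : ι → ℂ → ℂ}
    {G : ℂ → ℂ} (hF : ∀ i, Differentiable ℂ (F i))
    (h : TendstoLocallyUniformlyOn F G l Set.univ) (k : ℕ) :
    TendstoLocallyUniformlyOn (fun i => iteratedDeriv k (F i)) (iteratedDeriv k G) l
      Set.univ := by
  induction k with
  | zero => simpa using h
  | succ k ih =>
    simp only [iteratedDeriv_succ]
    refine ih.deriv (Eventually.of_forall fun i => ?_) isOpen_univ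
    exact (((hF i).contDiff (n := ((k + 1 : ℕ) : WithTop ℕ∞))).differentiable_iteratedDeriv k
      (by exact_mod_cast k.lt_succ_self)).differentiableOn

theorem exists_represents_of_tendstoLocallyUniformlyOn {ι : Type*} {l : Filter ι} [l.NeBot]
    {f : ι → PowerSeries ℝ} {F : ι → ℂ → ℂ} {G : ℂ → ℂ} (hF : ∀ i, Represents (f i) (F i))
    (h : TendstoLocallyUniformlyOn F G l Set.univ) :
    ∃ g, Represents g G ∧ Tendsto f l (𝓝 g) := by
  have hdiff (i : ι) : Differentiable ℂ (F i) := (hF i).differentiable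
  have hG : Differentiable ℂ G := by
    rw [← differentiableOn_univ]
    exact h.differentiableOn (Eventually.of_forall fun i => (hdiff i).differentiableOn) isOpen_univ
  have hlim (k : ℕ) : Tendsto (fun i => ((PowerSeries.coeff k (f i) : ℝ) : ℂ)) l
      (𝓝 ((k.factorial : ℂ)⁻¹ * iteratedDeriv k G 0)) := by
    simp only [fun i => (represents_iff.1 (hF i)).2 k]
    exact ((tendstoLocallyUniformlyOn_iteratedDeriv hdiff h k).tendsto_at
      (Set.mem_univ 0)).const_mul _
  have hreal (k : ℕ) : ∃ a : ℝ, (a : ℂ) = (k.factorial : ℂ)⁻¹ * iteratedDeriv k G 0 :=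
    isClosed_range_ofReal.mem_of_tendsto (hlim k) (Eventually.of_forall fun i => ⟨_, rfl⟩)
  choose a ha using hreal
  refine ⟨PowerSeries.mk a, represents_iff.2 ⟨hG, fun k => ?_⟩, ?_⟩
  · rw [PowerSeries.coeff_mk, ha]
  · rw [PowerSeries.WithPiTopology.tendsto_iff_coeff_tendsto]
    intro k
    rw [PowerSeries.coeff_mk]
    have := hlim k
    rw [← ha k] at this
    exact tendsto_ofReal_iff.1 this

/-! ### Exponentials -/

theorem norm_pow_sub_pow_le {R : Type*} [NormedField R] {a b : R} {M : ℝ} (ha : ‖a‖ ≤ M)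
    (hb : ‖b‖ ≤ M) (n : ℕ) : ‖a ^ n - b ^ n‖ ≤ n * M ^ (n - 1) * ‖a - b‖ := by
  rw [← geom_sum₂_mul, norm_mul]
  refine mul_le_mul_of_nonneg_right ?_ (norm_nonneg _)
  calc ‖∑ i ∈ Finset.range n, a ^ i * b ^ (n - 1 - i)‖
      ≤ ∑ i ∈ Finset.range n, ‖a ^ i * b ^ (n - 1 - i)‖ := norm_sum_le _ _
    _ ≤ ∑ _i ∈ Finset.range n, M ^ (n - 1) := by
      refine Finset.sum_le_sum fun i hi => ?_
      have hexp : n - 1 = i + (n - 1 - i) := by have := Finset.mem_range.1 hi; omega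
      rw [norm_mul, norm_pow, norm_pow]
      conv_rhs => rw [hexp, pow_add]
      gcongr
      exact pow_nonneg ((norm_nonneg a).trans ha) i
    _ = n * M ^ (n - 1) := by simp

theorem norm_one_add_div_pow_sub_exp_le {n : ℕ} {w : ℂ} {R : ℝ} (hw : ‖w‖ ≤ R) (hn : R ≤ n) :
    ‖(1 + w / n) ^ n - Complex.exp w‖ ≤ Real.exp R * R ^ 2 * (n : ℝ)⁻¹ := by
  have hR : 0 ≤ R := (norm_nonneg w).trans hw
  rcases eq_or_ne n 0 with rfl | hn0
  · obtain rfl : R = 0 := le_antisymm (by simpa using hn) hR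
    simp [norm_le_zero_iff.1 hw]
  have hnpos : (0 : ℝ) < n := by exact_mod_cast Nat.pos_of_ne_zero hn0
  have hquot : ‖w / n‖ ≤ R / n := by
    rw [norm_div, Complex.norm_natCast]
    gcongr
  have hpow : Complex.exp (w / n) ^ n = Complex.exp w := by
    rw [← Complex.exp_nat_mul, mul_div_cancel₀ _ (by exact_mod_cast hn0)]
  have hlin : ‖1 + w / n‖ ≤ Real.exp (R / n) :=
    calc ‖1 + w / n‖ ≤ 1 + R / n := (norm_add_le _ _).trans (by simpa using hquot)
      _ ≤ Real.exp (R / n) := by linarith [Real.add_one_le_exp (R / n)]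
  have hexp : ‖Complex.exp (w / n)‖ ≤ Real.exp (R / n) :=
    (Complex.norm_exp_le_exp_norm _).trans (Real.exp_le_exp.2 hquot)
  have hdiff : ‖(1 + w / n) - Complex.exp (w / n)‖ ≤ (R / n) ^ 2 := by
    rw [← norm_neg]
    calc ‖-(1 + w / n - Complex.exp (w / n))‖ = ‖Complex.exp (w / n) - 1 - w / n‖ := by
          congr 1; ring
      _ ≤ ‖w / n‖ ^ 2 := Complex.norm_exp_sub_one_sub_id_le
          (hquot.trans ((div_le_one hnpos).2 hn))
      _ ≤ (R / n) ^ 2 := by gcongr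
  calc ‖(1 + w / n) ^ n - Complex.exp w‖
      = ‖(1 + w / n) ^ n - Complex.exp (w / n) ^ n‖ := by rw [hpow]
    _ ≤ n * Real.exp (R / n) ^ (n - 1) * (R / n) ^ 2 :=
      (norm_pow_sub_pow_le hlin hexp n).trans (by gcongr)
    _ ≤ n * Real.exp (R / n) ^ n * (R / n) ^ 2 := by
      gcongr
      · exact Real.one_le_exp (by positivity)
      · omega
    _ = Real.exp R * R ^ 2 * (n : ℝ)⁻¹ := by
      rw [← Real.exp_nat_mul, mul_div_cancel₀ _ hnpos.ne']
      field_simp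

theorem tendstoLocallyUniformlyOn_one_add_div_pow_exp :
    TendstoLocallyUniformlyOn (fun (n : ℕ) (w : ℂ) => (1 + w / n) ^ n) Complex.exp atTop
      Set.univ := by
  rw [tendstoLocallyUniformlyOn_iff_forall_isCompact isOpen_univ]
  intro K _ hK
  obtain ⟨R, hR⟩ := hK.isBounded.exists_norm_le
  rw [Metric.tendstoUniformlyOn_iff]
  intro ε hε
  have hlim : Tendsto (fun n : ℕ => Real.exp R * R ^ 2 * (n : ℝ)⁻¹) atTop (𝓝 0) := by
    simpa using (tendsto_inv_atTop_nhds_zero_nat (𝕜 := ℝ)).const_mul (Real.exp R * R ^ 2)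
  filter_upwards [hlim.eventually_lt_const hε, eventually_ge_atTop ⌈R⌉₊] with n hsmall hn w hw
  rw [dist_comm, dist_eq_norm]
  exact (norm_one_add_div_pow_sub_exp_le (hR w hw) (Nat.ceil_le.1 hn)).trans_lt hsmall

theorem exists_represents_exp (q : ℝ[X]) :
    ∃ f, Represents f (fun z => Complex.exp (aeval z q)) ∧
      Tendsto (fun n : ℕ => (((1 + C (n : ℝ)⁻¹ * q) ^ n : ℝ[X]) : PowerSeries ℝ)) atTop (𝓝 f) := by
  refine exists_represents_of_tendstoLocallyUniformlyOn (fun n => represents_coe _) ?_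
  have := tendstoLocallyUniformlyOn_one_add_div_pow_exp.comp (fun z => aeval z q)
    (Set.mapsTo_univ _ Set.univ) q.continuous_aeval.continuousOn
  simpa [Function.comp_def, div_eq_inv_mul] using this

theorem powerSums_of_represents_exp {q : ℝ[X]} {f : PowerSeries ℝ}
    (hf : Represents f (fun z => Complex.exp (aeval z q))) :
    powerSums f = -((X * derivative q : ℝ[X]) : PowerSeries ℝ) := by
  have hconst : PowerSeries.constantCoeff f ≠ 0 := by
    have := hf.constantCoeff
    exact_mod_cast this ▸ Complex.exp_ne_zero _
  have hderiv : PowerSeries.derivative ℝ f = f * (derivative q : ℝ[X]) := by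
    refine hf.deriv.unique_left ?_
    convert hf.mul (represents_coe (derivative q)) using 2 with z
    exact (q.hasDerivAt_aeval z).cexp.deriv
  rw [powerSums_eq_iff hconst, hderiv]
  push_cast
  ring

/-! ### Limits of polynomials with few non-real zeros -/

/-- The coefficientwise limits of real polynomials that take the value `1` at the origin and have
at most `M` non-real zeros. -/
def limitClass (M : ℕ) : Set (PowerSeries ℝ) :=
  closure {f | ∃ p : ℝ[X], f = p ∧ p.coeff 0 = 1 ∧ rootDefect p ≤ M}

theorem coe_mem_limitClass {p : ℝ[X]} {M : ℕ} (h0 : p.coeff 0 = 1) (h : rootDefect p ≤ M) :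
    (p : PowerSeries ℝ) ∈ limitClass M :=
  subset_closure ⟨p, rfl, h0, h⟩

theorem mem_limitClass_of_tendsto {ι : Type*} {l : Filter ι} [l.NeBot] {f : ι → PowerSeries ℝ}
    {g : PowerSeries ℝ} {M : ℕ} (hf : ∀ i, f i ∈ limitClass M) (h : Tendsto f l (𝓝 g)) :
    g ∈ limitClass M :=
  isClosed_closure.mem_of_tendsto h (Eventually.of_forall hf)

theorem mul_mem_limitClass {M N : ℕ} {f g : PowerSeries ℝ} (hf : f ∈ limitClass M)
    (hg : g ∈ limitClass N) : f * g ∈ limitClass (M + N) := by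
  refine map_mem_closure₂ continuous_mul hf hg ?_
  rintro _ ⟨p, rfl, hp, hpM⟩ _ ⟨q, rfl, hq, hqN⟩
  refine ⟨p * q, by simp, by simp [mul_coeff_zero, hp, hq], ?_⟩
  exact (rootDefect_mul_le p q).trans (add_le_add hpM hqN)

theorem prod_mem_limitClass {ι : Type*} (s : Finset ι) {f : ι → PowerSeries ℝ}
    (h : ∀ i, f i ∈ limitClass 0) : ∏ i ∈ s, f i ∈ limitClass 0 := by
  classical
  induction s using Finset.induction_on with
  | empty =>
    have hone : rootDefect (1 : ℝ[X]) ≤ 0 := (rootDefect_eq_zero_iff.2 Splits.one).le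
    simpa using coe_mem_limitClass (by simp) hone
  | insert a s ha ih =>
    rw [Finset.prod_insert ha]
    exact mul_mem_limitClass (h a) ih

theorem constantCoeff_of_mem_limitClass {M : ℕ} {f : PowerSeries ℝ} (hf : f ∈ limitClass M) :
    PowerSeries.constantCoeff f = 1 := by
  have hclosed : IsClosed {f : PowerSeries ℝ | PowerSeries.constantCoeff f = 1} :=
    isClosed_eq (PowerSeries.WithPiTopology.continuous_constantCoeff ℝ) continuous_const
  refine closure_minimal ?_ hclosed hf
  rintro _ ⟨p, rfl, hp, -⟩
  simpa using! hp

theorem splits_one_sub_C_mul_X {K : Type*} [Field K] (b : K) : (1 - C b * X).Splits :=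
  Splits.of_natDegree_le_one (by compute_degree)

/-- The roots of `X ^ 2 + β X - α` are real, so `1 + β z - α z ^ 2` has only real zeros, and so has
`(1 + (β z - α z ^ 2) / n) ^ n`. -/
theorem exists_represents_exp_quadratic {α : ℝ} (hα : 0 ≤ α) (β : ℝ) :
    ∃ f ∈ limitClass 0, Represents f (fun z => Complex.exp (-α * z ^ 2 + β * z)) ∧
      powerSums f =
        PowerSeries.C (-β) * PowerSeries.X + PowerSeries.C (2 * α) * PowerSeries.X ^ 2 := by
  set q : ℝ[X] := C β * X - C α * X ^ 2 with hq
  have heval (z : ℂ) : aeval z q = -α * z ^ 2 + β * z := by simp [q]; ring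
  have hsplits (n : ℕ) : (1 + C (n : ℝ)⁻¹ * q).Splits := by
    set a := (n : ℝ)⁻¹ * α
    set b := (n : ℝ)⁻¹ * β
    have : 0 ≤ a := by positivity
    set d := √(b ^ 2 + 4 * a)
    have hd : d ^ 2 = b ^ 2 + 4 * a := Real.sq_sqrt (by positivity)
    set x := (-b + d) / 2
    set y := (-b - d) / 2
    have hsum : x + y = -b := by ring
    have hprod : x * y = -a := by linear_combination (-1 / 4) * hd
    have hfactor : 1 + C (n : ℝ)⁻¹ * q = (1 - C x * X) * (1 - C y * X) :=
      calc 1 + C (n : ℝ)⁻¹ * q = 1 - C (x + y) * X + C (x * y) * X ^ 2 := by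
            rw [hsum, hprod, hq]; simp only [a, b, C_mul, C_neg]; ring
        _ = (1 - C x * X) * (1 - C y * X) := by rw [C_add, C_mul]; ring
    rw [hfactor]
    exact (splits_one_sub_C_mul_X _).mul (splits_one_sub_C_mul_X _)
  obtain ⟨f, hf, hlim⟩ := exists_represents_exp q
  refine ⟨f, mem_limitClass_of_tendsto (fun n => coe_mem_limitClass ?_ ?_) hlim, ?_, ?_⟩
  · simp [coeff_zero_eq_eval_zero, q]
  · exact (rootDefect_eq_zero_iff.2 ((hsplits n).pow n)).le
  · simpa only [heval] using hf
  · rw [powerSums_of_represents_exp hf, hq]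
    simp only [derivative_sub, derivative_C_mul, derivative_X, derivative_X_pow]
    push_cast
    simp only [map_neg, map_mul, map_ofNat]
    ring

/-- The primary factor of genus one; the reciprocal `b` of the zero is allowed to be `0`. -/
noncomputable def primaryFactor (b : ℝ) (z : ℂ) : ℂ := (1 - b * z) * Complex.exp (b * z)

theorem exists_represents_primaryFactor (b : ℝ) :
    ∃ f ∈ limitClass 0, Represents f (primaryFactor b) ∧
      powerSums f = PowerSeries.mk fun k => if k ≤ 1 then 0 else b ^ k := by
  obtain ⟨e, he, heF, hes⟩ := exists_represents_exp_quadratic le_rfl b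
  have hlin := coe_mem_limitClass (M := 0) (p := 1 - C b * X) (by simp)
    (rootDefect_eq_zero_iff.2 (splits_one_sub_C_mul_X b)).le
  have hF : primaryFactor b = fun z =>
      aeval z (1 - C b * X) * Complex.exp (-(0 : ℝ) * z ^ 2 + b * z) := by
    ext z
    simp [primaryFactor]
  refine ⟨_, mul_mem_limitClass hlin he, hF ▸ (represents_coe _).mul heF, ?_⟩
  rw [powerSums_mul (by simp) (by simp [constantCoeff_of_mem_limitClass he]), hes]
  push_cast
  rw [powerSums_one_sub]
  ext k
  rcases k with _ | _ | k <;> simp [PowerSeries.coeff_succ_mul_X]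

theorem norm_primaryFactor_sub_one_le {b : ℝ} {z : ℂ} (h : ‖b * z‖ ≤ 1) :
    ‖primaryFactor b z - 1‖ ≤ 3 * ‖b * z‖ ^ 2 := by
  set w := b * z
  have hlin := Complex.norm_exp_sub_one_le h
  have hquad := Complex.norm_exp_sub_one_sub_id_le h
  calc ‖primaryFactor b z - 1‖ = ‖(Complex.exp w - 1 - w) - w * (Complex.exp w - 1)‖ := by
        rw [primaryFactor]; congr 1; ring
    _ ≤ ‖Complex.exp w - 1 - w‖ + ‖w‖ * ‖Complex.exp w - 1‖ := by
        rw [← norm_mul]; exact norm_sub_le _ _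
    _ ≤ ‖w‖ ^ 2 + ‖w‖ * (2 * ‖w‖) := by gcongr
    _ = 3 * ‖w‖ ^ 2 := by ring

theorem primaryFactor_ne_zero (b : ℝ) {z : ℂ} (hz : z ∈ nonreal) : primaryFactor b z ≠ 0 := by
  refine mul_ne_zero (fun h => hz ⟨b⁻¹, ?_⟩) (Complex.exp_ne_zero _)
  rw [Complex.ofReal_inv]
  exact inv_eq_of_mul_eq_one_right (sub_eq_zero.1 h).symm

section Product

variable {ι : Type*} {b : ι → ℝ}

theorem eventually_norm_primaryFactor_sub_one_le (hb : Summable fun j => b j ^ 2) (R : ℝ) :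
    ∀ᶠ j in cofinite, ∀ z : ℂ, ‖z‖ ≤ R → ‖primaryFactor (b j) z - 1‖ ≤ 3 * R ^ 2 * b j ^ 2 := by
  have hlim : Tendsto (fun j => b j ^ 2 * R ^ 2) cofinite (𝓝 0) := by
    simpa using hb.tendsto_cofinite_zero.mul_const (R ^ 2)
  filter_upwards [hlim.eventually_lt_const one_pos] with j hj z hz
  have hsq : ‖(b j : ℂ) * z‖ ^ 2 ≤ b j ^ 2 * R ^ 2 := by
    rw [norm_mul, mul_pow, Complex.norm_real, Real.norm_eq_abs, sq_abs]
    gcongr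
  have hle : ‖(b j : ℂ) * z‖ ≤ 1 := by
    rw [← abs_norm, ← sq_le_one_iff_abs_le_one]
    exact hsq.trans hj.le
  linarith [norm_primaryFactor_sub_one_le hle]

theorem tendstoLocallyUniformlyOn_primaryFactor (hb : Summable fun j => b j ^ 2) :
    TendstoLocallyUniformlyOn (fun (s : Finset ι) z => ∏ j ∈ s, primaryFactor (b j) z)
      (fun z => ∏' j, primaryFactor (b j) z) atTop Set.univ := by
  rw [← hasProdLocallyUniformlyOn_iff_tendstoLocallyUniformlyOn]
  refine hasProdLocallyUniformlyOn_of_forall_compact isOpen_univ fun S _ hS => ?_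
  obtain ⟨R, hR⟩ := hS.isBounded.exists_norm_le
  have hcont (j : ι) : ContinuousOn (fun z => primaryFactor (b j) z - 1) S := by
    unfold primaryFactor
    fun_prop
  have := Summable.hasProdUniformlyOn_one_add hS (hb.mul_left (3 * R ^ 2))
    ((eventually_norm_primaryFactor_sub_one_le hb R).mono fun j hj z hz => hj z (hR z hz)) hcont
  simpa using this

theorem summable_norm_primaryFactor_sub_one (hb : Summable fun j => b j ^ 2) (z : ℂ) :
    Summable fun j => ‖primaryFactor (b j) z - 1‖ := by
  refine (hb.mul_left (3 * ‖z‖ ^ 2)).of_norm_bounded_eventually ?_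
  filter_upwards [eventually_norm_primaryFactor_sub_one_le hb ‖z‖] with j hj
  simpa using hj z le_rfl

theorem hasProd_primaryFactor (hb : Summable fun j => b j ^ 2) (z : ℂ) :
    HasProd (fun j => primaryFactor (b j) z) (∏' j, primaryFactor (b j) z) := by
  simpa using (multipliable_one_add_of_summable (summable_norm_primaryFactor_sub_one hb z)).hasProd

theorem exists_represents_tprod_primaryFactor (hb : Summable fun j => b j ^ 2) :
    ∃ f ∈ limitClass 0, Represents f (fun z => ∏' j, primaryFactor (b j) z) ∧
      powerSums f = PowerSeries.mk fun k => if k ≤ 1 then 0 else ∑' j, b j ^ k := by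
  choose e he heF hes using fun j => exists_represents_primaryFactor (b j)
  have he0 (j : ι) : PowerSeries.constantCoeff (e j) ≠ 0 := by
    simp [constantCoeff_of_mem_limitClass (he j)]
  obtain ⟨f, hf, hlim⟩ := exists_represents_of_tendstoLocallyUniformlyOn
    (fun s : Finset ι => represents_prod s heF) (tendstoLocallyUniformlyOn_primaryFactor hb)
  have hfmem := mem_limitClass_of_tendsto (fun s => prod_mem_limitClass s he) hlim
  refine ⟨f, hfmem, hf, ?_⟩
  have hsums := tendsto_powerSums (by simp [constantCoeff_of_mem_limitClass hfmem]) hlim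
  rw [PowerSeries.WithPiTopology.tendsto_iff_coeff_tendsto] at hsums
  ext k
  have hk : HasSum (fun j => if k ≤ 1 then 0 else b j ^ k)
      (PowerSeries.coeff k (powerSums f)) := by
    simpa only [powerSums_prod _ he0, hes, map_sum, PowerSeries.coeff_mk] using! hsums k
  rw [PowerSeries.coeff_mk, ← hk.tsum_eq]
  split_ifs <;> simp

/-- The Laguerre-Pólya function with value `1` at the origin, Gaussian part `-α z ^ 2 + β z` and
zeros `1 / b j`; the indices with `b j = 0` contribute nothing. -/
noncomputable def lpFunction (α β : ℝ) (b : ι → ℝ) (z : ℂ) : ℂ :=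
  Complex.exp (-α * z ^ 2 + β * z) * ∏' j, primaryFactor (b j) z

theorem lpFunction_ne_zero (α β : ℝ) (hb : Summable fun j => b j ^ 2) {z : ℂ}
    (hz : z ∈ nonreal) : lpFunction α β b z ≠ 0 := by
  have := tprod_one_add_ne_zero_of_summable (f := fun j => primaryFactor (b j) z - 1)
    (fun j => by simpa using primaryFactor_ne_zero (b j) hz)
    (summable_norm_primaryFactor_sub_one hb z)
  exact mul_ne_zero (Complex.exp_ne_zero _) (by simpa using this)

theorem exists_represents_lpFunction {α : ℝ} (hα : 0 ≤ α) (β : ℝ)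
    (hb : Summable fun j => b j ^ 2) :
    ∃ f ∈ limitClass 0, Represents f (lpFunction α β b) ∧
      powerSums f =
        PowerSeries.C (-β) * PowerSeries.X + PowerSeries.C (2 * α) * PowerSeries.X ^ 2 +
          PowerSeries.mk fun k => if k ≤ 1 then 0 else ∑' j, b j ^ k := by
  obtain ⟨e, he, heF, hes⟩ := exists_represents_exp_quadratic hα β
  obtain ⟨f, hf, hfF, hfs⟩ := exists_represents_tprod_primaryFactor hb
  refine ⟨e * f, mul_mem_limitClass he hf, heF.mul hfF, ?_⟩
  rw [powerSums_mul (by simp [constantCoeff_of_mem_limitClass he])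
    (by simp [constantCoeff_of_mem_limitClass hf]), hes, hfs]

end Product

/-! ### Limits of real-rooted polynomials -/

theorem exists_tendsto_of_mem_limitClass {M : ℕ} {h : PowerSeries ℝ} (hh : h ∈ limitClass M) :
    ∃ p : ℕ → ℝ[X], (∀ n, (p n).coeff 0 = 1) ∧ (∀ n, rootDefect (p n) ≤ M) ∧
      Tendsto (fun n => (p n : PowerSeries ℝ)) atTop (𝓝 h) := by
  have : FirstCountableTopology (PowerSeries ℝ) :=
    inferInstanceAs (FirstCountableTopology ((Unit →₀ ℕ) → ℝ))
  obtain ⟨f, hf, hlim⟩ := mem_closure_iff_seq_limit.1 hh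
  choose p hfp hp0 hpM using hf
  exact ⟨p, hp0, hpM, hlim.congr hfp⟩

theorem exists_eq_prod_one_sub {K : Type*} [Field K] {p : K[X]} (hp : p.Splits)
    (h0 : p.coeff 0 = 1) {d : ℕ} (hd : p.natDegree ≤ d) :
    ∃ x : Fin d → K, p = ∏ i, (1 - C (x i) * X) := by
  have hlinear : ∀ a ∈ p.roots, X - C a = C (-a) * (1 - C a⁻¹ * X) := by
    intro a ha
    have ha0 : a ≠ 0 := by
      rintro rfl
      exact one_ne_zero (h0.symm.trans ((coeff_zero_eq_eval_zero p).trans (mem_roots'.1 ha).2))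
    have : C a * C a⁻¹ = (1 : K[X]) := by rw [← C_mul, mul_inv_cancel₀ ha0, C_1]
    rw [C_neg]
    linear_combination (-X) * this
  have hconst : ∃ c : K, p = C c * (p.roots.map fun a => 1 - C a⁻¹ * X).prod := by
    refine ⟨p.leadingCoeff * (p.roots.map fun a => -a).prod, ?_⟩
    conv_lhs => rw [hp.eq_prod_roots, Multiset.map_congr rfl hlinear, Multiset.prod_map_mul]
    rw [C_mul, map_multiset_prod, Multiset.map_map, mul_assoc]
    rfl
  obtain ⟨c, hc⟩ := hconst
  have hc1 : c = 1 := by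
    have heval := congrArg (evalRingHom 0) hc
    rw [map_mul, map_multiset_prod, Multiset.map_map] at heval
    simpa [← coeff_zero_eq_eval_zero, h0] using heval.symm
  obtain ⟨l, hl⟩ : ∃ l : List K, (l : Multiset K) = p.roots := Quot.exists_rep p.roots
  rw [hp.natDegree_eq_card_roots, ← hl, Multiset.coe_card] at hd
  obtain ⟨e, rfl⟩ := Nat.exists_eq_add_of_le hd
  refine ⟨Fin.append (fun i => l[i]⁻¹) 0, hc.trans ?_⟩
  rw [hc1, C_1, one_mul, ← hl, Multiset.map_coe, Multiset.prod_coe, Fin.prod_univ_add,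
    ← Fin.prod_univ_fun_getElem l fun a => 1 - C a⁻¹ * X]
  simp

theorem coe_prod_one_sub {K ι : Type*} [Field K] [Fintype ι] (x : ι → K) :
    ((∏ i, (1 - C (x i) * X) : K[X]) : PowerSeries K) =
      ∏ i, (1 - PowerSeries.C (x i) * PowerSeries.X) := by
  rw [← coeToPowerSeries.ringHom_apply, map_prod]
  simp

theorem coeff_powerSums_prod_one_sub {K ι : Type*} [Field K] [Fintype ι] (x : ι → K) {k : ℕ}
    (hk : k ≠ 0) :
    PowerSeries.coeff k (powerSums ((∏ i, (1 - C (x i) * X) : K[X]) : PowerSeries K)) =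
      ∑ i, x i ^ k := by
  rw [coe_prod_one_sub, powerSums_prod _ (by simp), map_sum]
  simp [powerSums_one_sub, hk]

theorem exists_antitone_enumeration {d : ℕ} (x : Fin d → ℝ) :
    ∃ y : ℕ → ℝ, Antitone (fun j => |y j|) ∧
      ∀ k, k ≠ 0 → HasSum (fun j => y j ^ k) (∑ i, x i ^ k) := by
  set σ := Tuple.sort fun i => -|x i|
  have hmono : Monotone ((fun i => -|x i|) ∘ σ) := Tuple.monotone_sort _
  refine ⟨fun j => if h : j < d then x (σ ⟨j, h⟩) else 0, fun i j hij => ?_, fun k hk => ?_⟩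
  · by_cases hj : j < d
    · have hi : i < d := hij.trans_lt hj
      have := hmono (show (⟨i, hi⟩ : Fin d) ≤ ⟨j, hj⟩ from hij)
      simp only [Function.comp_apply, neg_le_neg_iff] at this
      simpa [hi, hj] using this
    · simp [hj]
  · have hsum : ∑ i, x i ^ k = ∑ j ∈ Finset.range d,
        (if h : j < d then x (σ ⟨j, h⟩) else 0) ^ k := by
      rw [← Equiv.sum_comp σ, Finset.sum_range]
      simp
    rw [hsum]
    refine hasSum_sum_of_ne_finset_zero fun j hj => ?_
    have hjd : ¬ j < d := by simpa using hj
    simp [hjd, hk]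

theorem sq_le_div_of_antitone {y : ℕ → ℝ} (hy : Antitone fun j => |y j|) {s : ℝ}
    (hs : HasSum (fun j => y j ^ 2) s) (j : ℕ) : y j ^ 2 ≤ s / ((j : ℝ) + 1) := by
  rw [le_div_iff₀ (by positivity)]
  calc y j ^ 2 * (j + 1) = ∑ _i ∈ Finset.range (j + 1), y j ^ 2 := by simp [mul_comm]
    _ ≤ ∑ i ∈ Finset.range (j + 1), y i ^ 2 := Finset.sum_le_sum fun i hi =>
      sq_le_sq.2 (hy (Nat.lt_succ_iff.1 (Finset.mem_range.1 hi)))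
    _ ≤ s := sum_le_hasSum _ (fun i _ => sq_nonneg (y i)) hs

theorem summable_sqrt_div_pow (C : ℝ) {k : ℕ} (hk : 3 ≤ k) :
    Summable fun j : ℕ => √(C / ((j : ℝ) + 1)) ^ k := by
  have hsummable : Summable fun j : ℕ => (((j : ℝ) + 1) ^ (3 / 2 : ℝ))⁻¹ := by
    have := (summable_nat_add_iff 1).2
      (Real.summable_nat_rpow_inv.2 (show (1 : ℝ) < 3 / 2 by norm_num))
    simpa using this
  refine (hsummable.mul_left (√C ^ k)).of_nonneg_of_le (fun j => by positivity) fun j => ?_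
  have hj : (0 : ℝ) ≤ (j : ℝ) + 1 := by positivity
  have hcube : ((j : ℝ) + 1) ^ (3 / 2 : ℝ) = √((j : ℝ) + 1) ^ 3 := by
    rw [Real.sqrt_eq_rpow, ← Real.rpow_natCast, ← Real.rpow_mul hj]
    norm_num
  rw [Real.sqrt_div' _ hj, div_pow, div_eq_mul_inv, hcube]
  gcongr
  rw [Real.one_le_sqrt]
  linarith [(Nat.cast_nonneg j : (0 : ℝ) ≤ j)]

theorem exists_tendsto_subseq_of_abs_le {y : ℕ → ℕ → ℝ} {B : ℕ → ℝ} (h : ∀ n j, |y n j| ≤ B j) :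
    ∃ (b : ℕ → ℝ) (φ : ℕ → ℕ), StrictMono φ ∧
      ∀ j, Tendsto (fun n => y (φ n) j) atTop (𝓝 (b j)) := by
  have hcompact : IsCompact (Set.pi Set.univ fun j : ℕ => Set.Icc (-B j) (B j)) :=
    isCompact_univ_pi fun _ => isCompact_Icc
  obtain ⟨b, -, φ, hφ, hb⟩ := hcompact.tendsto_subseq (x := y) fun n j _ => abs_le.1 (h n j)
  exact ⟨b, φ, hφ, tendsto_pi_nhds.1 hb⟩

/-- Fatou only gives an inequality for the squares: mass escaping to infinitely many small terms
is what produces the Gaussian factor. For `k ≥ 3` the bound `y j ^ 2 ≤ C / (j + 1)` on the sorted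
terms makes dominated convergence available. -/
theorem exists_limit_power_sums {d : ℕ → ℕ} (x : ∀ n, Fin (d n) → ℝ) {S : ℕ → ℝ}
    (h : ∀ k, k ≠ 0 → Tendsto (fun n => ∑ i, x n i ^ k) atTop (𝓝 (S k))) :
    ∃ (α : ℝ) (b : ℕ → ℝ), 0 ≤ α ∧ Summable (fun j => b j ^ 2) ∧
      S 2 = 2 * α + ∑' j, b j ^ 2 ∧ ∀ k, 3 ≤ k → S k = ∑' j, b j ^ k := by
  choose y hy hsum using fun n => exists_antitone_enumeration (x n)
  obtain ⟨C, hC⟩ := (h 2 two_ne_zero).bddAbove_range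
  have hyle (n j) : |y n j| ≤ √(C / ((j : ℝ) + 1)) := by
    refine Real.abs_le_sqrt ((sq_le_div_of_antitone (hy n) (hsum n 2 two_ne_zero) j).trans ?_)
    exact div_le_div_of_nonneg_right (hC ⟨n, rfl⟩) (by positivity)
  obtain ⟨b, φ, hφ, hb⟩ := exists_tendsto_subseq_of_abs_le hyle
  have hS (k) (hk : k ≠ 0) : Tendsto (fun n => ∑ i, x (φ n) i ^ k) atTop (𝓝 (S k)) :=
    (h k hk).comp hφ.tendsto_atTop
  have hfatou (s : Finset ℕ) : ∑ j ∈ s, b j ^ 2 ≤ S 2 :=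
    le_of_tendsto_of_tendsto' (tendsto_finsetSum s fun j _ => (hb j).pow 2) (hS 2 two_ne_zero)
      fun n => sum_le_hasSum s (fun i _ => sq_nonneg _) (hsum (φ n) 2 two_ne_zero)
  have hbs : Summable fun j => b j ^ 2 := summable_of_sum_le (fun j => sq_nonneg _) hfatou
  refine ⟨(S 2 - ∑' j, b j ^ 2) / 2, b, ?_, hbs, by ring, fun k hk => ?_⟩
  · linarith [hbs.tsum_le_of_sum_le hfatou]
  · have hk0 : k ≠ 0 := by omega
    have hdom := tendsto_tsum_of_dominated_convergence (𝓕 := atTop)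
      (f := fun n j => y (φ n) j ^ k) (g := fun j => b j ^ k)
      (summable_sqrt_div_pow C hk) (fun j => (hb j).pow k)
      (Eventually.of_forall fun n j => by
        rw [norm_pow, Real.norm_eq_abs]
        exact pow_le_pow_left₀ (abs_nonneg _) (hyle _ j) k)
    simp only [(hsum _ k hk0).tsum_eq] at hdom
    exact tendsto_nhds_unique (hS k hk0) hdom

theorem exists_represents_of_mem_limitClass_zero {g : PowerSeries ℝ} (hg : g ∈ limitClass 0) :
    ∃ (α β : ℝ) (b : ℕ → ℝ), 0 ≤ α ∧ Summable (fun j => b j ^ 2) ∧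
      Represents g (lpFunction α β b) := by
  obtain ⟨p, hp0, hp, hlim⟩ := exists_tendsto_of_mem_limitClass hg
  have hg0 := constantCoeff_of_mem_limitClass hg
  choose x hx using fun n =>
    exists_eq_prod_one_sub (rootDefect_eq_zero_iff.1 (Nat.le_zero.1 (hp n))) (hp0 n) le_rfl
  have hsums := tendsto_powerSums (by simp [hg0]) hlim
  rw [PowerSeries.WithPiTopology.tendsto_iff_coeff_tendsto] at hsums
  have hpsum (n) {k : ℕ} (hk : k ≠ 0) :
      PowerSeries.coeff k (powerSums (p n : PowerSeries ℝ)) = ∑ i, x n i ^ k := by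
    rw [← coeff_powerSums_prod_one_sub (x n) hk, ← hx n]
  obtain ⟨α, b, hα, hb, h2, h3⟩ := exists_limit_power_sums x
    (S := fun k => PowerSeries.coeff k (powerSums g)) fun k hk =>
      (hsums k).congr fun n => hpsum n hk
  set β := -PowerSeries.coeff 1 (powerSums g)
  obtain ⟨f, hf, hfF, hfs⟩ := exists_represents_lpFunction hα β hb
  have hf0 := constantCoeff_of_mem_limitClass hf
  refine ⟨α, β, b, hα, hb, ?_⟩
  convert hfF
  refine eq_of_powerSums_eq (by simp [hg0]) (hg0.trans hf0.symm) ?_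
  ext k
  simp only [hfs, map_add, PowerSeries.coeff_C_mul, PowerSeries.coeff_X, PowerSeries.coeff_X_pow,
    PowerSeries.coeff_mk]
  rcases k with _ | _ | _ | k
  · simp [powerSums]
  · simp [β]
  · simp [h2]
  · simp [h3]

theorem isLP_lpFunction {α : ℝ} (hα : 0 ≤ α) (β : ℝ) {b : ℕ → ℝ}
    (hb : Summable fun j => b j ^ 2) : IsLP (lpFunction α β b) := by
  refine ⟨1, 0, α, β, {j | b j ≠ 0}, fun j => (b j)⁻¹, fun z => ∏' j, primaryFactor (b j) z, hα,
    fun j => inv_ne_zero j.2, ?_, fun z => ?_, fun z => by simp [lpFunction]⟩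
  · refine (hb.subtype _).congr fun j => ?_
    simp [abs_inv]
  · have hsupport : Function.mulSupport (fun j => primaryFactor (b j) z) ⊆ {j | b j ≠ 0} := by
      intro j hj hj0
      exact hj (by simp [primaryFactor, hj0])
    have := (hasProd_subtype_iff_of_mulSupport_subset hsupport).2 (hasProd_primaryFactor hb z)
    convert! this using 2 with j
    simp [primaryFactor, mul_comm, div_eq_mul_inv]

theorem IsLP.exists_eq_lpFunction {F : ℂ → ℂ} (hF : IsLP F) :
    ∃ (c : ℝ) (m : ℕ) (α β : ℝ) (J : Set ℕ) (b : J → ℝ), 0 ≤ α ∧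
      Summable (fun j => b j ^ 2) ∧ ∀ z, F z = c * z ^ m * lpFunction α β b z := by
  obtain ⟨c, m, α, β, J, a, G, hα, -, ha, hG, hFz⟩ := hF
  refine ⟨c, m, α, β, J, fun j => (a j)⁻¹, hα, ha.congr fun j => by simp, fun z => ?_⟩
  have hprod : HasProd (fun j => primaryFactor (a j)⁻¹ z) (G z) := by
    convert! hG z using 2 with j
    simp [primaryFactor, div_eq_inv_mul]
  rw [hFz, lpFunction, hprod.tprod_eq, mul_assoc]

/-! ### Separating the non-real zeros -/

theorem exists_splits_mul_of_coeff_zero {K : Type*} [Field K] {p : K[X]} (h0 : p.coeff 0 = 1) :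
    ∃ s q : K[X], p = s * q ∧ s.Splits ∧ s.coeff 0 = 1 ∧ q.coeff 0 = 1 ∧
      q.natDegree = rootDefect p := by
  obtain ⟨s, q, h, hs, hq⟩ := exists_splits_mul p
  have hsq : s.coeff 0 * q.coeff 0 = 1 := by rw [← mul_coeff_zero, ← h, h0]
  have hs0 : s.coeff 0 ≠ 0 := left_ne_zero_of_mul_eq_one hsq
  refine ⟨C (s.coeff 0)⁻¹ * s, C (s.coeff 0) * q, ?_, hs.C_mul _, by simp [hs0], by simp [hsq],
    by rw [natDegree_C_mul hs0, hq]⟩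
  rw [mul_mul_mul_comm, ← C_mul, inv_mul_cancel₀ hs0, C_1, one_mul, h]

theorem coeff_powerSums_nonneg {s : ℝ[X]} (hs : s.Splits) (h0 : s.coeff 0 = 1) {k : ℕ}
    (hk : k ≠ 0) (heven : Even k) : 0 ≤ PowerSeries.coeff k (powerSums (s : PowerSeries ℝ)) := by
  obtain ⟨x, hx⟩ := exists_eq_prod_one_sub hs h0 le_rfl
  rw [hx, coeff_powerSums_prod_one_sub x hk]
  exact Finset.sum_nonneg fun i _ => heven.pow_nonneg (x i)

theorem ofReal_coeff_powerSums {q : ℝ[X]} (h0 : q.coeff 0 = 1) {ι : Type*} [Fintype ι]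
    {u : ι → ℂ} (hu : q.map (algebraMap ℝ ℂ) = ∏ i, (1 - C (u i) * X)) {k : ℕ} (hk : k ≠ 0) :
    ((PowerSeries.coeff k (powerSums (q : PowerSeries ℝ)) : ℝ) : ℂ) = ∑ i, u i ^ k := by
  rw [← coeff_powerSums_prod_one_sub u hk, ← hu, polynomial_map_coe,
    powerSums_map _ (by simp [h0]), PowerSeries.coeff_map, Complex.coe_algebraMap]

/-- The powers of `v ^ 2` in the compact group `Circle ^ ι` come back to every neighbourhood of
`1`. -/
theorem exists_even_pow_re_gt {ι : Type*} [Finite ι] (v : ι → Circle) :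
    ∃ k, k ≠ 0 ∧ Even k ∧ ∀ i, 1 / 2 < ((v i : ℂ) ^ k).re := by
  have hopen : IsOpen {w : ι → Circle | ∀ i, 1 / 2 < (w i : ℂ).re} := by
    simp only [Set.ofPred_forall]
    refine isOpen_iInter_of_finite fun i => isOpen_lt continuous_const ?_
    exact Complex.continuous_re.comp (continuous_subtype_val.comp (continuous_apply i))
  have hone : (1 : ι → Circle) ∈ {w : ι → Circle | ∀ i, 1 / 2 < (w i : ℂ).re} := by
    intro _
    norm_num
  have hfreq := (mapClusterPt_one_atTop_pow (v ^ 2)).frequently (hopen.mem_nhds hone)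
  obtain ⟨j, hj, hj1⟩ := (hfreq.and_eventually (eventually_ge_atTop 1)).exists
  refine ⟨2 * j, by lia, even_two_mul j, fun i => ?_⟩
  simpa [pow_mul] using hj i

section PowerSums

variable {ι : Type*} [Fintype ι]

theorem norm_le_of_re_sum_pow_le {u : ι → ℂ} {w : ι → Circle} (hw : ∀ i, u i = ‖u i‖ * w i) {k : ℕ}
    (hk : k ≠ 0) (hre : ∀ i, 1 / 2 < ((w i : ℂ) ^ k).re) {C : ℝ} (hC : (∑ i, u i ^ k).re ≤ C) :
    ‖u‖ ≤ max 1 (2 * C) := by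
  have hterm (i : ι) : ‖u i‖ ^ k / 2 ≤ (u i ^ k).re := by
    have hpow : u i ^ k = ((‖u i‖ ^ k : ℝ) : ℂ) * (w i : ℂ) ^ k := by
      rw [Complex.ofReal_pow, ← mul_pow, ← hw i]
    rw [hpow, Complex.re_ofReal_mul, div_eq_mul_one_div]
    exact mul_le_mul_of_nonneg_left (hre i).le (by positivity)
  refine (pi_norm_le_iff_of_nonneg (by positivity)).2 fun i => ?_
  have hpow : ‖u i‖ ^ k ≤ 2 * C := by
    have hsum : ‖u i‖ ^ k / 2 ≤ ∑ j, (u j ^ k).re :=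
      (hterm i).trans (Finset.single_le_sum (f := fun j => (u j ^ k).re)
        (fun j _ => le_trans (by positivity) (hterm j)) (Finset.mem_univ i))
    rw [← Complex.re_sum] at hsum
    linarith
  rcases le_total ‖u i‖ 1 with h | h
  · exact h.trans (le_max_left _ _)
  · exact (le_self_pow₀ h hk).trans (hpow.trans (le_max_right _ _))

theorem exists_tendsto_subseq_of_re_sum_pow_le {u : ℕ → ι → ℂ}
    (h : ∀ k, k ≠ 0 → Even k → ∃ C, ∀ n, (∑ i, u n i ^ k).re ≤ C) :
    ∃ (v : ι → ℂ) (φ : ℕ → ℕ), StrictMono φ ∧ Tendsto (u ∘ φ) atTop (𝓝 v) := by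
  set w : ℕ → ι → Circle := fun n i => Circle.exp (u n i).arg
  have hw (n i) : u n i = ‖u n i‖ * w n i := by
    rw [Circle.coe_exp, Complex.norm_mul_exp_arg_mul_I]
  obtain ⟨v, φ, hφ, hv⟩ := CompactSpace.tendsto_subseq w
  obtain ⟨k, hk, heven, hvk⟩ := exists_even_pow_re_gt v
  obtain ⟨C, hC⟩ := h k hk heven
  have hre : ∀ᶠ n in atTop, ∀ i, 1 / 2 < ((w (φ n) i : ℂ) ^ k).re := by
    refine eventually_all.2 fun i => ?_
    have hcont : Continuous fun z : Circle => ((z : ℂ) ^ k).re := by fun_prop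
    exact ((hcont.tendsto _).comp (tendsto_pi_nhds.1 hv i)).eventually (lt_mem_nhds (hvk i))
  have hbounded : ∀ᶠ n in atTop, (u ∘ φ) n ∈ Metric.closedBall 0 (max 1 (2 * C)) :=
    hre.mono fun n hn =>
      mem_closedBall_zero_iff.2 (norm_le_of_re_sum_pow_le (hw (φ n)) hk hn (hC (φ n)))
  obtain ⟨a, -, ψ, hψ, ha⟩ :=
    tendsto_subseq_of_frequently_bounded Metric.isBounded_closedBall hbounded.frequently
  exact ⟨a, φ ∘ ψ, hφ.comp hψ, ha⟩

end PowerSums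

theorem exists_tendsto_coe_of_tendsto_map {M : ℕ} {q : ℕ → ℝ[X]} (hq : ∀ n, (q n).natDegree ≤ M)
    {g : PowerSeries ℂ}
    (h : Tendsto (fun n => (((q n).map (algebraMap ℝ ℂ) : ℂ[X]) : PowerSeries ℂ)) atTop (𝓝 g)) :
    ∃ Q : ℝ[X], Q.natDegree ≤ M ∧
      Tendsto (fun n => (q n : PowerSeries ℝ)) atTop (𝓝 (Q : PowerSeries ℝ)) := by
  refine ⟨PowerSeries.trunc (M + 1) (PowerSeries.mk fun k => (PowerSeries.coeff k g).re),
    Nat.lt_succ_iff.1 (PowerSeries.natDegree_trunc_lt _ _), ?_⟩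
  rw [PowerSeries.WithPiTopology.tendsto_iff_coeff_tendsto] at h ⊢
  intro k
  simp only [coeff_coe, PowerSeries.coeff_trunc, PowerSeries.coeff_mk]
  split_ifs with hk
  · simpa [Function.comp_def] using (Complex.continuous_re.tendsto _).comp (h k)
  · refine tendsto_const_nhds.congr fun n => (coeff_eq_zero_of_natDegree_lt ?_).symm
    exact (hq n).trans_lt (by lia)

theorem exists_tendsto_subseq_of_powerSums_le {M : ℕ} {q : ℕ → ℝ[X]}
    (hq : ∀ n, (q n).natDegree ≤ M) (h0 : ∀ n, (q n).coeff 0 = 1)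
    (h : ∀ k, k ≠ 0 → Even k →
      ∃ C, ∀ n, PowerSeries.coeff k (powerSums (q n : PowerSeries ℝ)) ≤ C) :
    ∃ (Q : ℝ[X]) (φ : ℕ → ℕ), StrictMono φ ∧ Q.natDegree ≤ M ∧
      Tendsto (fun n => (q (φ n) : PowerSeries ℝ)) atTop (𝓝 (Q : PowerSeries ℝ)) := by
  choose u hu using fun n => exists_eq_prod_one_sub (d := M)
    (IsAlgClosed.splits ((q n).map (algebraMap ℝ ℂ))) (by simp [h0 n]) (by simpa using hq n)
  obtain ⟨v, φ, hφ, hv⟩ := exists_tendsto_subseq_of_re_sum_pow_le (u := u) fun k hk heven => by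
    obtain ⟨C, hC⟩ := h k hk heven
    refine ⟨C, fun n => ?_⟩
    rw [← ofReal_coeff_powerSums (h0 n) (hu n) hk, Complex.ofReal_re]
    exact hC n
  have hlim : Tendsto (fun n => (((q (φ n)).map (algebraMap ℝ ℂ) : ℂ[X]) : PowerSeries ℂ)) atTop
      (𝓝 (∏ i, (1 - PowerSeries.C (v i) * PowerSeries.X))) := by
    simp only [hu, coe_prod_one_sub]
    refine tendsto_finsetProd _ fun i _ =>
      tendsto_const_nhds.sub (Tendsto.mul ?_ tendsto_const_nhds)
    exact (PowerSeries.WithPiTopology.continuous_C.tendsto _).comp (tendsto_pi_nhds.1 hv i)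
  obtain ⟨Q, hQ, hqQ⟩ := exists_tendsto_coe_of_tendsto_map (fun n => hq (φ n)) hlim
  exact ⟨Q, φ, hφ, hQ, hqQ⟩

theorem exists_eq_coe_mul_of_mem_limitClass {M : ℕ} {h : PowerSeries ℝ} (hh : h ∈ limitClass M) :
    ∃ (Q : ℝ[X]) (g : PowerSeries ℝ), Q.natDegree ≤ M ∧ g ∈ limitClass 0 ∧ h = Q * g := by
  obtain ⟨p, hp0, hp, hlim⟩ := exists_tendsto_of_mem_limitClass hh
  have hh0 := constantCoeff_of_mem_limitClass hh
  choose s q hsq hs hs0 hq0 hq using fun n => exists_splits_mul_of_coeff_zero (hp0 n)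
  have hsums := tendsto_powerSums (by simp [hh0]) hlim
  rw [PowerSeries.WithPiTopology.tendsto_iff_coeff_tendsto] at hsums
  obtain ⟨Q, φ, hφ, hQ, hqQ⟩ := exists_tendsto_subseq_of_powerSums_le
    (fun n => (hq n).trans_le (hp n)) hq0 fun k hk heven => by
      obtain ⟨C, hC⟩ := (hsums k).bddAbove_range
      refine ⟨C, fun n => le_trans ?_ (hC ⟨n, rfl⟩)⟩
      simp only [hsq n, coe_mul]
      rw [powerSums_mul (by simp [hs0 n]) (by simp [hq0 n]), map_add]
      exact le_add_of_nonneg_left (coeff_powerSums_nonneg (hs n) (hs0 n) hk heven)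
  have hQ0 : PowerSeries.constantCoeff (Q : PowerSeries ℝ) = 1 := by
    refine tendsto_nhds_unique
      (((PowerSeries.WithPiTopology.continuous_constantCoeff ℝ).tendsto _).comp hqQ) ?_
    simp [Function.comp_def, hq0]
  have hinv := tendsto_powerSeries_inv (by simp [hQ0]) hqQ
  refine ⟨Q, h * (Q : PowerSeries ℝ)⁻¹, hQ, mem_limitClass_of_tendsto (fun n => ?_)
    ((hlim.comp hφ.tendsto_atTop).mul hinv), ?_⟩
  · have hcancel : (p (φ n) : PowerSeries ℝ) * (q (φ n) : PowerSeries ℝ)⁻¹ = s (φ n) := by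
      rw [hsq, coe_mul, mul_assoc, PowerSeries.mul_inv_cancel _ (by simp [hq0]), mul_one]
    rw [Function.comp_apply, hcancel]
    exact coe_mem_limitClass (hs0 _) (rootDefect_eq_zero_iff.2 (hs _)).le
  · rw [mul_left_comm, PowerSeries.mul_inv_cancel _ (by simp [hQ0]), mul_one]

/-! ### Appell polynomials and the class `LP*` -/

theorem rootDefect_le_of_coe_mem_limitClass {p : ℝ[X]} {M : ℕ}
    (h : (p : PowerSeries ℝ) ∈ limitClass M) : rootDefect p ≤ M := by
  obtain ⟨Q, g, hQ, hg, hpQg⟩ := exists_eq_coe_mul_of_mem_limitClass h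
  obtain ⟨α, β, b, -, hb, hrep⟩ := exists_represents_of_mem_limitClass_zero hg
  have heq : (fun z : ℂ => aeval z p) = fun z => aeval z Q * lpFunction α β b z :=
    (represents_coe p).unique_right (hpQg ▸ (represents_coe Q).mul hrep)
  have hcount : rootDefect p = rootDefect Q := by
    rw [← ENat.natCast_inj, ← zeroCount_aeval p, heq]
    exact zeroCount_aeval_mul hrep.differentiable fun z => lpFunction_ne_zero α β hb
  exact hcount ▸ (rootDefect_le_natDegree Q).trans hQ

theorem jensen_coe_mem_limitClass {p : ℝ[X]} {M : ℕ} (h0 : p.coeff 0 = 1) (hp : rootDefect p ≤ M)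
    (n : ℕ) : (jensen (p : PowerSeries ℝ) n : PowerSeries ℝ) ∈ limitClass M := by
  refine mem_limitClass_of_tendsto (fun r => ?_)
    ((tendsto_jensenApprox p n).comp (tendsto_add_atTop_nat p.natDegree))
  have hdeg : p.natDegree ≤ n + (r + p.natDegree) := by lia
  refine coe_mem_limitClass ?_ ((rootDefect_jensenApprox_le hdeg).trans hp)
  rw [coeff_jensenApprox hdeg (Nat.zero_le _)]
  simp [h0]

theorem mem_limitClass_iff {h : PowerSeries ℝ} (h0 : PowerSeries.constantCoeff h = 1) {M : ℕ} :
    h ∈ limitClass M ↔ ∀ n, rootDefect (appell h n) ≤ M := by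
  refine ⟨fun hh n => ?_, fun hM => ?_⟩
  · rw [← rootDefect_jensen]
    refine rootDefect_le_of_coe_mem_limitClass
      (closure_minimal ?_ (isClosed_closure.preimage (continuous_jensen n)) hh)
    rintro _ ⟨p, rfl, hp0, hp⟩
    exact jensen_coe_mem_limitClass hp0 hp n
  · refine mem_limitClass_of_tendsto (fun n => coe_mem_limitClass ?_ ?_) (tendsto_jensen_comp h)
    · simp [comp_C_mul_X_coeff, coeff_jensen, h0]
    · refine (rootDefect_comp_le _ ((natDegree_C_mul_le _ _).trans natDegree_X_le)).trans ?_
      exact (rootDefect_jensen h n).trans_le (hM n)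

theorem exists_polynomial_eq_C_mul_X_pow_mul {K : Type*} [Field K] {R : K[X]} (hR : R ≠ 0) :
    ∃ (c : K) (m : ℕ) (p : K[X]), c ≠ 0 ∧ p.coeff 0 = 1 ∧ R = C c * X ^ m * p := by
  obtain ⟨q, hq, hdvd⟩ := exists_eq_pow_rootMultiplicity_mul_and_not_dvd R hR 0
  rw [C_0, sub_zero] at hq hdvd
  have hq0 : q.coeff 0 ≠ 0 := fun h => hdvd (X_dvd_iff.2 h)
  refine ⟨q.coeff 0, rootMultiplicity 0 R, C (q.coeff 0)⁻¹ * q, hq0, by simp [hq0], ?_⟩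
  have hcancel : C (q.coeff 0) * C (q.coeff 0)⁻¹ = 1 := by rw [← C_mul, mul_inv_cancel₀ hq0, C_1]
  linear_combination hq - X ^ rootMultiplicity 0 R * q * hcancel

theorem rootDefect_appell_coe_mul_le (R : ℝ[X]) {g : PowerSeries ℝ} (hg : g ∈ limitClass 0)
    (n : ℕ) : rootDefect (appell (R * g) n) ≤ rootDefect R := by
  rcases eq_or_ne R 0 with rfl | hR
  · simp [appell]
  obtain ⟨c, m, p, hc, hp0, rfl⟩ := exists_polynomial_eq_C_mul_X_pow_mul hR
  have hmem : (p : PowerSeries ℝ) * g ∈ limitClass (rootDefect p) :=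
    mul_mem_limitClass (coe_mem_limitClass hp0 le_rfl) hg
  rw [rootDefect_splits_mul (Splits.C_mul_X_pow c m) (by simp [hc])]
  simp only [coe_mul, coe_C, coe_pow, coe_X, mul_assoc _ (p : PowerSeries ℝ)]
  exact (forall_rootDefect_appell_C_mul_X_pow_mul_le_iff hc m _ _).2
    ((mem_limitClass_iff (constantCoeff_of_mem_limitClass hmem)).1 hmem) n

theorem exists_eq_coe_mul_of_rootDefect_appell_le {f : PowerSeries ℝ} {M : ℕ}
    (hM : ∀ n, rootDefect (appell f n) ≤ M) :
    ∃ (R : ℝ[X]) (g : PowerSeries ℝ), g ∈ limitClass 0 ∧ f = R * g ∧ rootDefect R ≤ M := by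
  rcases eq_or_ne f 0 with rfl | hf
  · exact ⟨0, (1 : ℝ[X]), coe_mem_limitClass (by simp) (rootDefect_eq_zero_iff.2 Splits.one).le,
      by simp, by simp⟩
  obtain ⟨c, m, h, hc, h0, rfl⟩ := exists_powerSeries_eq_C_mul_X_pow_mul hf
  have hmem : h ∈ limitClass M :=
    (mem_limitClass_iff h0).2 ((forall_rootDefect_appell_C_mul_X_pow_mul_le_iff hc m h M).1 hM)
  obtain ⟨Q, g, hQ, hg, rfl⟩ := exists_eq_coe_mul_of_mem_limitClass hmem
  refine ⟨C c * X ^ m * Q, g, hg, ?_,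
    (rootDefect_splits_mul_le (Splits.C_mul_X_pow c m) Q).trans hQ⟩
  simp [mul_assoc]

theorem exists_represents_coe_mul (R : ℝ[X]) {g : PowerSeries ℝ} (hg : g ∈ limitClass 0) :
    ∃ F, Represents (R * g) F ∧ IsLPStar F ∧ zeroCount F nonreal = rootDefect R := by
  obtain ⟨α, β, b, hα, hb, hrep⟩ := exists_represents_of_mem_limitClass_zero hg
  have hmul := (represents_coe R).mul hrep
  exact ⟨_, hmul, ⟨hmul.isRealEntire, R, _, isLP_lpFunction hα β hb, fun _ => rfl⟩,
    zeroCount_aeval_mul hrep.differentiable fun z => lpFunction_ne_zero α β hb⟩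

theorem IsLPStar.exists_eq_coe_mul {f : PowerSeries ℝ} {F : ℂ → ℂ} (hF : IsLPStar F)
    (hf : Represents f F) :
    ∃ (R : ℝ[X]) (g : PowerSeries ℝ), g ∈ limitClass 0 ∧ f = R * g ∧
      zeroCount F nonreal = rootDefect R := by
  obtain ⟨-, P, G, hG, hFG⟩ := hF
  obtain ⟨c, m, α, β, J, b, hα, hb, hGz⟩ := hG.exists_eq_lpFunction
  obtain ⟨g, hg, hrep, -⟩ := exists_represents_lpFunction hα β hb
  have hFR : F = fun z => aeval z (P * (C c * X ^ m)) * lpFunction α β b z := by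
    ext z
    simp [hFG, hGz, mul_assoc]
  refine ⟨P * (C c * X ^ m), g, hg, hf.unique_left (hFR ▸ (represents_coe _).mul hrep), ?_⟩
  rw [hFR]
  exact zeroCount_aeval_mul hrep.differentiable fun z => lpFunction_ne_zero α β hb

theorem forall_rootDefect_appell_le_iff {f : PowerSeries ℝ} {M : ℕ} :
    (∀ n, rootDefect (appell f n) ≤ M) ↔
      ∃ F, Represents f F ∧ IsLPStar F ∧ zeroCount F nonreal ≤ M := by
  refine ⟨fun hM => ?_, fun ⟨F, hf, hF, hM⟩ n => ?_⟩
  · obtain ⟨R, g, hg, rfl, hR⟩ := exists_eq_coe_mul_of_rootDefect_appell_le hM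
    obtain ⟨F, hf, hF, hcount⟩ := exists_represents_coe_mul R hg
    exact ⟨F, hf, hF, hcount.trans_le (Nat.cast_le.2 hR)⟩
  · obtain ⟨R, g, hg, rfl, hcount⟩ := hF.exists_eq_coe_mul hf
    exact (rootDefect_appell_coe_mul_le R hg n).trans (Nat.cast_le.1 (hcount.symm.trans_le hM))

theorem exists_isLUB_rootDefect_appell {f : PowerSeries ℝ} {F : ℂ → ℂ} (hf : Represents f F)
    (hF : IsLPStar F) :
    ∃ N : ℕ, zeroCount F nonreal = N ∧
      IsLUB (Set.range fun n => rootDefect (appell f n)) N := by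
  obtain ⟨R, -, -, -, hcount⟩ := hF.exists_eq_coe_mul hf
  refine ⟨rootDefect R, hcount, ?_, fun L hL => ?_⟩
  · rintro _ ⟨n, rfl⟩
    exact forall_rootDefect_appell_le_iff.2 ⟨F, hf, hF, hcount.le⟩ n
  · obtain ⟨F', hf', -, hL'⟩ := forall_rootDefect_appell_le_iff.1 fun n => hL ⟨n, rfl⟩
    rw [hf'.unique_right hf, hcount] at hL'
    exact Nat.cast_le.1 hL'

theorem appellNonrealZeros_eq (f : PowerSeries ℝ) (n : ℕ) :
    appellNonrealZeros f n = rootDefect (appell f n) :=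
  zeroCount_aeval _

theorem rootDefect_appell_eq_zero (f : PowerSeries ℝ) {n : ℕ} (hn : n ≤ 1) :
    rootDefect (appell f n) = 0 :=
  rootDefect_eq_zero_iff.2 (Splits.of_natDegree_le_one ((natDegree_appell_le f n).trans hn))

end LaguerrePolya

theorem theorem3p6 (f : PowerSeries ℝ) :
    (LaguerrePolya.appellNonrealZeros f 0 = 0 ∧ LaguerrePolya.appellNonrealZeros f 1 = 0 ∧
      ∀ n : ℕ, LaguerrePolya.appellNonrealZeros f n ≤ LaguerrePolya.appellNonrealZeros f (n + 1)) ∧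
    (∀ F : ℂ → ℂ, LaguerrePolya.Represents f F → LaguerrePolya.IsLPStar F →
      (∀ n : ℕ, LaguerrePolya.appellNonrealZeros f n ≤
        LaguerrePolya.zeroCount F LaguerrePolya.nonreal) ∧
      ∃ n₀ : ℕ, ∀ n : ℕ, n₀ ≤ n →
        LaguerrePolya.appellNonrealZeros f n =
          LaguerrePolya.zeroCount F LaguerrePolya.nonreal) ∧
    ((∃ B : ℕ, ∀ n : ℕ, LaguerrePolya.appellNonrealZeros f n ≤ (B : ℕ∞)) →
      ∃ F : ℂ → ℂ, LaguerrePolya.Represents f F ∧ LaguerrePolya.IsLPStar F) := by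
  simp only [LaguerrePolya.appellNonrealZeros_eq, Nat.cast_le]
  have hmono := LaguerrePolya.rootDefect_appell_mono f
  refine ⟨⟨?_, ?_, fun n => hmono n.le_succ⟩, fun F hf hF => ?_, fun ⟨B, hB⟩ => ?_⟩
  · rw [LaguerrePolya.rootDefect_appell_eq_zero f zero_le_one, Nat.cast_zero]
  · rw [LaguerrePolya.rootDefect_appell_eq_zero f le_rfl, Nat.cast_zero]
  · obtain ⟨N, hN, hlub⟩ := LaguerrePolya.exists_isLUB_rootDefect_appell hf hF
    simp only [hN, Nat.cast_le, Nat.cast_inj]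
    have hlim := tendsto_atTop_isLUB hmono hlub
    rw [nhds_discrete, Filter.tendsto_pure] at hlim
    exact ⟨fun n => hlub.1 ⟨n, rfl⟩, Filter.eventually_atTop.1 hlim⟩
  · obtain ⟨F, hf, hF, -⟩ := LaguerrePolya.forall_rootDefect_appell_le_iff.1 hB
    exact ⟨F, hf, hF⟩
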